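/- Write $D_x=-i\partial_x$, $D_y=-i\partial_y$, $\langle t\rangle=(1+t^2)^{1/2}$, and let $\|\cdot\|$ be the norm of $L^2(\mathbb R^2)$. Weight. Let $a>1$ and let $\varphi\in C^3(\mathbb R)$ satisfy $\varphi'>0$ on $\mathbb R$, $\varphi(x)=\arctan(x-a+\pi/4)$ for $x\ge a$, $\varphi(x)=-1/x$ for $x\le -a$, and $1/a\le\varphi(x)\le 1$ for $|x|<a$. Potential. Let $A_0,A_1>0$. For $s>1/2$, consider real-valued functions $V$ on $\mathbb R^2$ such that $V$ and $\partial_xV$ exist and are continuous on $\mathbb R^2$ and $$\sup_{x,y}\langle x\rangle^{2s}|V(x,y)|\le A_0,\qquad \sup_{x,y}\langle x\rangle|\partial_xV(x,y)|\le A_1 .$$ No condition is imposed on the support of $V$. Let $$H=(D_x+y)^2+D_y^2+x+V(x,y)$$ be the operator in $L^2(\mathbb R^2)$ obtained as the closure of this differential expression on $C_0^\infty(\mathbb R^2)$. Lemma. There is a constant $C>0$, depending only on $a$, $\varphi$, $A_0$ and $A_1$, such that for every $s>1/2$, every such $V$, every $\lambda\in\mathbb R$ and every eigenfunction $\psi$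 of $H$ with eigenvalue $\lambda$ and $\|\psi\|=1$, the distributional derivatives $D_x\psi$, $D_y\psi$ are locally integrable functions, the functions $\sqrt{\varphi'(x)}\,(D_x+y)\psi$ and $\sqrt{\varphi(x)}\sqrt{\varphi'(y)}\,D_y\psi$ belong to $L^2(\mathbb R^2)$, and $$\bigl\|\sqrt{\varphi'(x)}\,(D_x+y)\psi\bigr\|\le C\langle\lambda\rangle^{1/4},\qquad \bigl\|\sqrt{\varphi(x)}\sqrt{\varphi'(y)}\,D_y\psi\bigr\|\le C\langle\lambda\rangle^{3/8}.$$ In particular $C$ is independent of $\psi$, $\lambda$ and the support of $V$. -/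

import Mathlib

open MeasureTheory
open scoped ContDiff

noncomputable section

namespace MagneticStark

/-- The Hilbert space `L²(ℝ²)` of complex-valued functions, with Lebesgue measure. -/
abbrev L2 : Type := Lp ℂ 2 (volume : Measure (ℝ × ℝ))

/-- `⟨t⟩ = (1 + t²)^{1/2}`. -/
def japanese (t : ℝ) : ℝ := Real.sqrt (1 + t ^ 2)

/-- Classical partial derivative in the first variable `x`. -/
def partialX {E : Type} [NormedAddCommGroup E] [NormedSpace ℝ E] (u : ℝ × ℝ → E) (p : ℝ × ℝ) : E :=
  deriv (fun t : ℝ => u (t, p.2)) p.1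

/-- Classical partial derivative in the second variable `y`. -/
def partialY {E : Type} [NormedAddCommGroup E] [NormedSpace ℝ E] (u : ℝ × ℝ → E) (p : ℝ × ℝ) : E :=
  deriv (fun t : ℝ => u (p.1, t)) p.2

/-- `D_x = -i ∂_x` on differentiable functions. -/
def opDx (u : ℝ × ℝ → ℂ) : ℝ × ℝ → ℂ := fun p => -Complex.I * partialX u p

/-- `D_y = -i ∂_y` on differentiable functions. -/
def opDy (u : ℝ × ℝ → ℂ) : ℝ × ℝ → ℂ := fun p => -Complex.I * partialY u p

/-- The magnetic derivative `D_x + y` on differentiable functions. -/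
def opP (u : ℝ × ℝ → ℂ) : ℝ × ℝ → ℂ := fun p => opDx u p + (p.2 : ℂ) * u p

/-- The differential expression `((D_x + y)² + D_y² + x + V) u`. -/
def formalH (V : ℝ × ℝ → ℝ) (u : ℝ × ℝ → ℂ) : ℝ × ℝ → ℂ := fun p =>
  opP (opP u) p + opDy (opDy u) p + (p.1 : ℂ) * u p + (V p : ℂ) * u p

/-- The space `C₀^∞(ℝ²)` of test functions. -/
def IsTest (u : ℝ × ℝ → ℂ) : Prop := ContDiff ℝ ∞ u ∧ HasCompactSupport u

/-! ### Calculus on test functions, needed to see that the operator below is well defined -/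

lemma hasDerivAt_x {u : ℝ × ℝ → ℂ} (hu : IsTest u) (p : ℝ × ℝ) :
    HasDerivAt (fun t : ℝ => u (t, p.2)) (fderiv ℝ u p (1, 0)) p.1 := by
  have h1 : HasFDerivAt u (fderiv ℝ u p) (p.1, p.2) :=
    (hu.1.differentiable (by simp) p).hasFDerivAt
  exact h1.comp_hasDerivAt p.1 ((hasDerivAt_id p.1).prodMk (hasDerivAt_const p.1 p.2))

lemma hasDerivAt_y {u : ℝ × ℝ → ℂ} (hu : IsTest u) (p : ℝ × ℝ) :
    HasDerivAt (fun t : ℝ => u (p.1, t)) (fderiv ℝ u p (0, 1)) p.2 := by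
  have h1 : HasFDerivAt u (fderiv ℝ u p) (p.1, p.2) :=
    (hu.1.differentiable (by simp) p).hasFDerivAt
  exact h1.comp_hasDerivAt p.2 ((hasDerivAt_const p.2 p.1).prodMk (hasDerivAt_id p.2))

lemma partialX_eq {u : ℝ × ℝ → ℂ} (hu : IsTest u) :
    partialX u = fun p => fderiv ℝ u p (1, 0) := funext fun p => (hasDerivAt_x hu p).deriv

lemma partialY_eq {u : ℝ × ℝ → ℂ} (hu : IsTest u) :
    partialY u = fun p => fderiv ℝ u p (0, 1) := funext fun p => (hasDerivAt_y hu p).deriv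

lemma IsTest.fderiv_apply {u : ℝ × ℝ → ℂ} (hu : IsTest u) (v : ℝ × ℝ) :
    IsTest (fun p => fderiv ℝ u p v) :=
  ⟨(hu.1.fderiv_right (m := ∞) (by simp)).clm_apply contDiff_const,
    hu.2.fderiv_apply ℝ v⟩

lemma IsTest.mul_left {u g : ℝ × ℝ → ℂ} (hu : IsTest u) (hg : ContDiff ℝ ∞ g) :
    IsTest (fun p => g p * u p) := ⟨hg.mul hu.1, hu.2.mul_left⟩

lemma IsTest.add {u v : ℝ × ℝ → ℂ} (hu : IsTest u) (hv : IsTest v) :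
    IsTest (fun p => u p + v p) := ⟨hu.1.add hv.1, hu.2.add hv.2⟩

lemma IsTest.opDx {u : ℝ × ℝ → ℂ} (hu : IsTest u) : IsTest (opDx u) := by
  unfold MagneticStark.opDx
  rw [partialX_eq hu]
  exact (hu.fderiv_apply _).mul_left contDiff_const

lemma IsTest.opDy {u : ℝ × ℝ → ℂ} (hu : IsTest u) : IsTest (opDy u) := by
  unfold MagneticStark.opDy
  rw [partialY_eq hu]
  exact (hu.fderiv_apply _).mul_left contDiff_const

lemma IsTest.opP {u : ℝ × ℝ → ℂ} (hu : IsTest u) : IsTest (opP u) :=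
  hu.opDx.add (hu.mul_left (Complex.ofRealCLM.contDiff.comp contDiff_snd))

lemma opDx_comb {u v : ℝ × ℝ → ℂ} (hu : IsTest u) (hv : IsTest v) (c : ℂ) :
    opDx (fun p => c * u p + v p) = fun p => c * opDx u p + opDx v p := by
  funext p
  have := (((hasDerivAt_x hu p).const_mul c).add (hasDerivAt_x hv p)).deriv
  simp only [opDx, partialX, (hasDerivAt_x hu p).deriv, (hasDerivAt_x hv p).deriv]
  erw [this]
  ring

lemma opDy_comb {u v : ℝ × ℝ → ℂ} (hu : IsTest u) (hv : IsTest v) (c : ℂ) :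
    opDy (fun p => c * u p + v p) = fun p => c * opDy u p + opDy v p := by
  funext p
  have := (((hasDerivAt_y hu p).const_mul c).add (hasDerivAt_y hv p)).deriv
  simp only [opDy, partialY, (hasDerivAt_y hu p).deriv, (hasDerivAt_y hv p).deriv]
  erw [this]
  ring

lemma opP_comb {u v : ℝ × ℝ → ℂ} (hu : IsTest u) (hv : IsTest v) (c : ℂ) :
    opP (fun p => c * u p + v p) = fun p => c * opP u p + opP v p := by
  funext p
  simp only [opP, opDx_comb hu hv]
  ring

lemma formalH_comb (V : ℝ × ℝ → ℝ) {u v : ℝ × ℝ → ℂ} (hu : IsTest u) (hv : IsTest v) (c : ℂ) :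
    formalH V (fun p => c * u p + v p) = fun p => c * formalH V u p + formalH V v p := by
  funext p
  simp only [formalH, opP_comb hu hv, opDy_comb hu hv, opP_comb hu.opP hv.opP,
    opDy_comb hu.opDy hv.opDy]
  ring

lemma isTest_zero : IsTest (fun _ => 0) := ⟨contDiff_const, HasCompactSupport.zero⟩

lemma formalH_zero (V : ℝ × ℝ → ℝ) : formalH V (fun _ => 0) = fun _ => 0 := by
  funext p
  have h := congrFun (formalH_comb V isTest_zero isTest_zero 1) p
  simpa using h

/-- The graph `{(u, H u) : u ∈ C₀^∞(ℝ²)}` in `L²(ℝ²) × L²(ℝ²)`. -/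
def minimalGraph (V : ℝ × ℝ → ℝ) : Submodule ℂ (L2 × L2) where
  carrier := {q | ∃ u : ℝ × ℝ → ℂ, IsTest u ∧ q.1 =ᵐ[volume] u ∧ q.2 =ᵐ[volume] formalH V u}
  zero_mem' := ⟨fun _ => 0, isTest_zero, Lp.coeFn_zero _ _ _,
    by rw [formalH_zero]; exact Lp.coeFn_zero _ _ _⟩
  add_mem' := by
    rintro q r ⟨u, hu, h1, h2⟩ ⟨v, hv, h3, h4⟩
    refine ⟨fun p => 1 * u p + v p, (hu.mul_left contDiff_const).add hv, ?_, ?_⟩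
    · filter_upwards [Lp.coeFn_add q.1 r.1, h1, h3] with p a b c
      rw [one_mul, ← b, ← c]
      exact a
    · rw [formalH_comb V hu hv]
      filter_upwards [Lp.coeFn_add q.2 r.2, h2, h4] with p a b c
      rw [one_mul, ← b, ← c]
      exact a
  smul_mem' := by
    rintro c q ⟨u, hu, h1, h2⟩
    refine ⟨fun p => c * u p + 0, (hu.mul_left contDiff_const).add isTest_zero, ?_, ?_⟩
    · filter_upwards [Lp.coeFn_smul c q.1, h1] with p a b
      simp [a, b]
    · rw [formalH_comb V hu isTest_zero, formalH_zero]
      filter_upwards [Lp.coeFn_smul c q.2, h2] with p a b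
      simp [a, b]

/-- The operator `(D_x + y)² + D_y² + x + V` with domain `C₀^∞(ℝ²)`. -/
def minimalH (V : ℝ × ℝ → ℝ) : L2 →ₗ.[ℂ] L2 := (minimalGraph V).toLinearPMap

/-- The magnetic Stark Hamiltonian `H = (D_x + y)² + D_y² + x + V` in `L²(ℝ²)`: the closure of its
restriction to `C₀^∞(ℝ²)`. -/
def hamiltonian (V : ℝ × ℝ → ℝ) : L2 →ₗ.[ℂ] L2 := (minimalH V).closure

/-! ### Closability -/

lemma IsTest.memLp {u : ℝ × ℝ → ℂ} (hu : IsTest u) : MemLp u 2 volume :=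
  hu.1.continuous.memLp_of_hasCompactSupport hu.2

lemma IsTest.conj {u : ℝ × ℝ → ℂ} (hu : IsTest u) : IsTest (fun p => (starRingEnd ℂ) (u p)) :=
  ⟨Complex.conjCLE.contDiff.comp hu.1, hu.2.comp_left (g := (starRingEnd ℂ)) (by simp)⟩

lemma parts {u v : ℝ × ℝ → ℂ} (hu : IsTest u) (hv : IsTest v) (e : ℝ × ℝ) :
    ∫ p, (starRingEnd ℂ) (v p) * (-Complex.I * fderiv ℝ u p e) =
      ∫ p, (starRingEnd ℂ) (-Complex.I * fderiv ℝ v p e) * u p := by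
  have hI : ∀ {f g : ℝ × ℝ → ℂ}, IsTest f → IsTest g → Integrable (fun p => f p * g p) :=
    fun hf hg => (hg.mul_left hf.1).1.continuous.integrable_of_hasCompactSupport
      (hg.mul_left hf.1).2
  have hs : ∀ p, fderiv ℝ (fun p => (starRingEnd ℂ) (v p)) p e = (starRingEnd ℂ) (fderiv ℝ v p e) := by
    intro p
    have := (Complex.conjCLE.toContinuousLinearMap.hasFDerivAt.comp p
      (hv.1.differentiable (by simp) p).hasFDerivAt).fderiv
    have h2 := congrArg (fun L => L e) this
    exact h2
  have key := integral_mul_fderiv_eq_neg_fderiv_mul_of_integrable (v := e) (μ := volume)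
    (f := fun p => (starRingEnd ℂ) (v p)) (g := u)
    (hI (hv.conj.fderiv_apply e) hu) (hI hv.conj (hu.fderiv_apply e)) (hI hv.conj hu)
    (fun p _ => hv.conj.1.differentiable (by simp) p) (fun p _ => hu.1.differentiable (by simp) p)
  simp only [hs] at key
  calc _ = -Complex.I * ∫ p, (starRingEnd ℂ) (v p) * fderiv ℝ u p e := by
        rw [← integral_const_mul]; congr 1; funext p; ring
    _ = Complex.I * ∫ p, (starRingEnd ℂ) (fderiv ℝ v p e) * u p := by rw [key]; ring
    _ = _ := by
        rw [← integral_const_mul]; congr 1; funext p; simp; ring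

lemma opDx_symm {u v : ℝ × ℝ → ℂ} (hu : IsTest u) (hv : IsTest v) :
    ∫ p, (starRingEnd ℂ) (v p) * opDx u p = ∫ p, (starRingEnd ℂ) (opDx v p) * u p := by
  simp only [opDx, partialX_eq hu, partialX_eq hv]
  exact parts hu hv _

lemma opDy_symm {u v : ℝ × ℝ → ℂ} (hu : IsTest u) (hv : IsTest v) :
    ∫ p, (starRingEnd ℂ) (v p) * opDy u p = ∫ p, (starRingEnd ℂ) (opDy v p) * u p := by
  simp only [opDy, partialY_eq hu, partialY_eq hv]
  exact parts hu hv _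

lemma integrable_conj_mul {u v : ℝ × ℝ → ℂ} (hu : Continuous u) (hv : Continuous v)
    (h : HasCompactSupport u ∨ HasCompactSupport v) :
    Integrable (fun p => (starRingEnd ℂ) (v p) * u p) := by
  refine ((Complex.continuous_conj.comp hv).mul hu).integrable_of_hasCompactSupport ?_
  rcases h with h | h
  · exact h.mul_left
  · exact (h.comp_left (g := (starRingEnd ℂ)) (by simp)).mul_right

lemma opP_symm {u v : ℝ × ℝ → ℂ} (hu : IsTest u) (hv : IsTest v) :
    ∫ p, (starRingEnd ℂ) (v p) * opP u p = ∫ p, (starRingEnd ℂ) (opP v p) * u p := by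
  have hy : Continuous fun p : ℝ × ℝ => (p.2 : ℂ) := by fun_prop
  have cu := hu.1.continuous
  have cv := hv.1.continuous
  simp only [opP, map_add, mul_add, add_mul]
  have i2 : Integrable fun p => (starRingEnd ℂ) (v p) * ((p.2 : ℂ) * u p) :=
    integrable_conj_mul (hy.mul cu) cv (Or.inr hv.2)
  have j2 : Integrable fun p => (starRingEnd ℂ) ((p.2 : ℂ) * v p) * u p :=
    integrable_conj_mul cu (hy.mul cv) (Or.inl hu.2)
  rw [integral_add (integrable_conj_mul hu.opDx.1.continuous cv (Or.inr hv.2)) i2,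
    integral_add (integrable_conj_mul cu hv.opDx.1.continuous (Or.inl hu.2)) j2, opDx_symm hu hv]
  congr 2
  funext p
  simp
  ring

lemma formalH_continuous {V : ℝ × ℝ → ℝ} (hV : Continuous V) {u : ℝ × ℝ → ℂ} (hu : IsTest u) :
    Continuous (formalH V u) :=
  ((hu.opP.opP.1.continuous.add hu.opDy.opDy.1.continuous).add
    ((by fun_prop : Continuous fun p : ℝ × ℝ => (p.1 : ℂ)).mul hu.1.continuous)).add
    ((by fun_prop : Continuous fun p : ℝ × ℝ => (V p : ℂ)).mul hu.1.continuous)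

lemma formalH_hasCompactSupport (V : ℝ × ℝ → ℝ) {u : ℝ × ℝ → ℂ} (hu : IsTest u) :
    HasCompactSupport (formalH V u) :=
  ((hu.opP.opP.2.add hu.opDy.opDy.2).add hu.2.mul_left).add hu.2.mul_left

lemma formalH_symm {V : ℝ × ℝ → ℝ} (hV : Continuous V) {u v : ℝ × ℝ → ℂ} (hu : IsTest u)
    (hv : IsTest v) :
    ∫ p, (starRingEnd ℂ) (v p) * formalH V u p = ∫ p, (starRingEnd ℂ) (formalH V v p) * u p := by
  have hx : Continuous fun p : ℝ × ℝ => (p.1 : ℂ) := by fun_prop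
  have hW : Continuous fun p : ℝ × ℝ => (V p : ℂ) := by fun_prop
  have cu := hu.1.continuous
  have cv := hv.1.continuous
  have i1 := integrable_conj_mul hu.opP.opP.1.continuous cv (Or.inr hv.2)
  have i2 := integrable_conj_mul hu.opDy.opDy.1.continuous cv (Or.inr hv.2)
  have i3 : Integrable fun p => (starRingEnd ℂ) (v p) * ((p.1 : ℝ) * u p) :=
    integrable_conj_mul (hx.mul cu) cv (Or.inr hv.2)
  have i4 : Integrable fun p => (starRingEnd ℂ) (v p) * ((V p : ℝ) * u p) :=
    integrable_conj_mul (hW.mul cu) cv (Or.inr hv.2)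
  have j1 := integrable_conj_mul cu hv.opP.opP.1.continuous (Or.inl hu.2)
  have j2 := integrable_conj_mul cu hv.opDy.opDy.1.continuous (Or.inl hu.2)
  have j3 : Integrable fun p => (starRingEnd ℂ) ((p.1 : ℝ) * v p) * u p :=
    integrable_conj_mul cu (hx.mul cv) (Or.inl hu.2)
  have j4 : Integrable fun p => (starRingEnd ℂ) ((V p : ℝ) * v p) * u p :=
    integrable_conj_mul cu (hW.mul cv) (Or.inl hu.2)
  simp only [formalH, map_add, mul_add, add_mul]
  rw [integral_add ((i1.fun_add i2).fun_add i3) i4, integral_add (i1.fun_add i2) i3,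
    integral_add i1 i2, integral_add ((j1.fun_add j2).fun_add j3) j4,
    integral_add (j1.fun_add j2) j3, integral_add j1 j2,
    opP_symm hu.opP hv, opP_symm hu hv.opP, opDy_symm hu.opDy hv, opDy_symm hu hv.opDy]
  congr 2
  · congr 2
    funext p
    simp
    ring
  · funext p
    simp
    ring

lemma inner_toLp {v : ℝ × ℝ → ℂ} (hv : MemLp v 2 volume) (f : L2) :
    inner ℂ (hv.toLp v) f = ∫ p, (starRingEnd ℂ) (v p) * f p := by
  rw [L2.inner_def]
  refine integral_congr_ae ?_
  filter_upwards [hv.coeFn_toLp] with p h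
  rw [h, RCLike.inner_apply, mul_comm]

lemma eq_zero_of_mem_closure {V : ℝ × ℝ → ℝ} (hV : Continuous V) (q : L2 × L2)
    (hq : q ∈ (minimalGraph V).topologicalClosure) (h0 : q.1 = 0) : q.2 = 0 := by
  have main : ∀ v : ℝ × ℝ → ℂ, IsTest v → ∫ p, (starRingEnd ℂ) (v p) * q.2 p = 0 := by
    intro v hv
    have hHv : MemLp (formalH V v) 2 volume :=
      (formalH_continuous hV hv).memLp_of_hasCompactSupport (formalH_hasCompactSupport V hv)
    have hcl : IsClosed {r : L2 × L2 |
        inner ℂ (hv.memLp.toLp v) r.2 = inner ℂ (hHv.toLp (formalH V v)) r.1} :=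
      isClosed_eq (by fun_prop) (by fun_prop)
    have hsub : ((minimalGraph V : Set (L2 × L2))) ⊆ {r : L2 × L2 |
        inner ℂ (hv.memLp.toLp v) r.2 = inner ℂ (hHv.toLp (formalH V v)) r.1} := by
      rintro r ⟨u, hu, h1, h2⟩
      simp only [Set.mem_ofPred_eq, inner_toLp]
      have e1 : ∫ p, (starRingEnd ℂ) (v p) * r.2 p =
          ∫ p, (starRingEnd ℂ) (v p) * formalH V u p :=
        integral_congr_ae (by filter_upwards [h2] with p h; rw [h])
      have e2 : ∫ p, (starRingEnd ℂ) (formalH V v p) * r.1 p =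
          ∫ p, (starRingEnd ℂ) (formalH V v p) * u p :=
        integral_congr_ae (by filter_upwards [h1] with p h; rw [h])
      rw [e1, e2, formalH_symm hV hu hv]
    have := closure_minimal hsub hcl hq
    rw [Set.mem_ofPred_eq, h0, inner_zero_right, inner_toLp] at this
    exact this
  have hae : ∀ᵐ p ∂(volume : Measure (ℝ × ℝ)), q.2 p = 0 := by
    refine ae_eq_zero_of_integral_contDiff_smul_eq_zero
      ((Lp.memLp q.2).locallyIntegrable (by norm_num)) ?_
    intro g hg hgs
    have := main (fun p => (g p : ℂ)) ⟨Complex.ofRealCLM.contDiff.comp hg,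
      hgs.comp_left (g := fun t : ℝ => (t : ℂ)) (by simp)⟩
    simpa using this
  exact (Lp.eq_zero_iff_ae_eq_zero).2 hae

/-- The graph of the operator on `C₀^∞(ℝ²)` is what it should be. -/
lemma minimalH_graph {V : ℝ × ℝ → ℝ} (hV : Continuous V) : (minimalH V).graph = minimalGraph V :=
  Submodule.toLinearPMap_graph_eq _ fun q hq h0 =>
    eq_zero_of_mem_closure hV q (Submodule.le_topologicalClosure _ hq) h0

/-- The operator on `C₀^∞(ℝ²)` is closable, so that its closure has the expected meaning. -/
lemma minimalH_isClosable {V : ℝ × ℝ → ℝ} (hV : Continuous V) : (minimalH V).IsClosable :=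
  ⟨(minimalGraph V).topologicalClosure.toLinearPMap, by
    rw [minimalH_graph hV]
    exact (Submodule.toLinearPMap_graph_eq _ (eq_zero_of_mem_closure hV)).symm⟩

/-- The graph of `H` is the closure of its restriction to `C₀^∞(ℝ²)`. -/
lemma hamiltonian_graph {V : ℝ × ℝ → ℝ} (hV : Continuous V) :
    (hamiltonian V).graph = (minimalGraph V).topologicalClosure := by
  rw [hamiltonian, ← (minimalH_isClosable hV).graph_closure_eq_closure_graph, minimalH_graph hV]

/-! ### Eigenfunctions, potentials, weights, weak derivatives -/

/-- `ψ` is an eigenfunction of `H` with eigenvalue `lam`. -/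
def IsEigenfunction (V : ℝ × ℝ → ℝ) (lam : ℝ) (ψ : L2) : Prop :=
  ψ ≠ 0 ∧ ∃ h : ψ ∈ (hamiltonian V).domain, hamiltonian V ⟨ψ, h⟩ = (lam : ℂ) • ψ

/-- The assumptions on the potential: `V` and `∂_x V` exist and are continuous on `ℝ²`,
`⟨x⟩^{2s} |V| ≤ A₀` and `⟨x⟩ |∂_x V| ≤ A₁`. There is no condition on the support of `V`. -/
structure IsPotential (s A₀ A₁ : ℝ) (V : ℝ × ℝ → ℝ) : Prop where
  continuous : Continuous V
  differentiable_x : ∀ p : ℝ × ℝ, DifferentiableAt ℝ (fun t : ℝ => V (t, p.2)) p.1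
  continuous_partialX : Continuous (partialX V)
  bound : ∀ p : ℝ × ℝ, japanese p.1 ^ (2 * s) * |V p| ≤ A₀
  bound_partialX : ∀ p : ℝ × ℝ, japanese p.1 * |partialX V p| ≤ A₁

/-- The weight functions `φ`: `C³`, with positive derivative, equal to `arctan (x - a + π/4)` for
`x ≥ a` and to `-1/x` for `x ≤ -a`, with values in `[1/a, 1]` in between. In particular
`0 < φ < π/2`. -/
structure IsWeight (a : ℝ) (φ : ℝ → ℝ) : Prop where
  contDiff : ContDiff ℝ 3 φ
  deriv_pos : ∀ x, 0 < deriv φ x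
  right : ∀ x, a ≤ x → φ x = Real.arctan (x - a + Real.pi / 4)
  left : ∀ x, x ≤ -a → φ x = -1 / x
  middle : ∀ x, -a < x → x < a → 1 / a ≤ φ x ∧ φ x ≤ 1

/-- `g` is the weak (distributional) `D_x f = -i ∂_x f`, as a locally integrable function. -/
def IsWeakDx (f g : ℝ × ℝ → ℂ) : Prop :=
  LocallyIntegrable g ∧ ∀ η : ℝ × ℝ → ℂ, IsTest η → ∫ p, g p * η p = -∫ p, f p * opDx η p

/-- `g` is the weak (distributional) `D_y f = -i ∂_y f`, as a locally integrable function. -/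
def IsWeakDy (f g : ℝ × ℝ → ℂ) : Prop :=
  LocallyIntegrable g ∧ ∀ η : ℝ × ℝ → ℂ, IsTest η → ∫ p, g p * η p = -∫ p, f p * opDy η p

end MagneticStark

end

noncomputable section

namespace MagneticStark

/-! The proof is a positive-commutator argument on test functions, followed by a passage to the
limit. For a test function `u` write G = (∂_x + iy)u, E = ∂_y u and f = (H - λ)u.

Energy: pairing f with φ(x)u controls ∫ φ(x)(|G|² + |E|²). The linear potential is unbounded below,
but φ(x)x ≥ -a because φ = -1/x far to the left, so the bound is a multiple of ‖u‖‖f‖ + ⟨λ⟩‖u‖²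
(`energy_estimate`). The weighted derivatives are therefore of size ⟨λ⟩^{1/2}.

Virial in x: pairing f with 2φ(x)G + φ'(x)u makes 2∫ φ'(x)|G|² appear (`virial_identity_x`). The
eigenvalue disappears, since x + V - λ enters only through its x-derivative. What remains is at most
linear in the energy quantities, hence O(⟨λ⟩^{1/2}), and a square root gives the exponent 1/4.

Virial in y: pairing f with 2φ(x)φ(y)E + φ(x)φ'(y)u makes 2∫ φ(x)φ'(y)|E|² appear
(`virial_identity_y`). Here x - λ drops out, and V is never differentiated. The x-dependence of the
weight leaves a cross term φ'(x)φ(y) Re(Ē G), of size ⟨λ⟩^{1/2}⟨λ⟩^{1/4}. Its square root gives 3/8.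

Limit: an eigenfunction is a graph limit of test functions u_n with (H - λ)u_n → 0, because H is a
closure. The energy estimate is homogeneous, so applied to u_n - u_m it makes the √φ-weighted
derivatives Cauchy in L². Division by √φ > 0 identifies the limits with weak derivatives
(`integral_weak_limit`). Since φ' ≤ Kφ, the weights in the theorem are bounded multiples of √φ(x),
so the uniform bounds survive (`memLp_mul_limit`). The constants see V only through sup|V| ≤ A₀ and
sup|∂_x V| ≤ A₁, which is why they depend neither on s nor on the support of V. -/

/-- The covariant derivative `∂_x + i y`, so that `D_x + y = -i (∂_x + i y)`. -/
def covX (u : ℝ × ℝ → ℂ) (p : ℝ × ℝ) : ℂ :=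
  fderiv ℝ u p (1, 0) + Complex.I * (p.2 : ℂ) * u p

/-- The derivative `∂_y`, written with the Fréchet derivative. -/
def derY (u : ℝ × ℝ → ℂ) (p : ℝ × ℝ) : ℂ := fderiv ℝ u p (0, 1)

/-! ### Calculus of the covariant derivative on test functions -/

lemma contDiff_snd_complex : ContDiff ℝ ∞ fun p : ℝ × ℝ => (p.2 : ℂ) :=
  Complex.ofRealCLM.contDiff.comp contDiff_snd

lemma IsTest.covX {u : ℝ × ℝ → ℂ} (hu : IsTest u) : IsTest (covX u) :=
  (hu.fderiv_apply _).add (hu.mul_left (contDiff_const.mul contDiff_snd_complex))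

lemma IsTest.derY {u : ℝ × ℝ → ℂ} (hu : IsTest u) : IsTest (derY u) := hu.fderiv_apply _

lemma IsTest.const_mul {u : ℝ × ℝ → ℂ} (hu : IsTest u) (c : ℂ) : IsTest (fun p => c * u p) :=
  hu.mul_left contDiff_const

lemma IsTest.sub {u v : ℝ × ℝ → ℂ} (hu : IsTest u) (hv : IsTest v) :
    IsTest (fun p => u p - v p) := ⟨hu.1.sub hv.1, hu.2.sub hv.2⟩

lemma IsTest.differentiableAt {u : ℝ × ℝ → ℂ} (hu : IsTest u) (p : ℝ × ℝ) :
    DifferentiableAt ℝ u p := hu.1.differentiable (by simp) p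

lemma opP_eq {u : ℝ × ℝ → ℂ} (hu : IsTest u) : opP u = fun p => -Complex.I * covX u p := by
  funext p
  simp only [opP, opDx, partialX_eq hu, covX]
  linear_combination (p.2 : ℂ) * u p * Complex.I_sq

lemma opDy_eq {u : ℝ × ℝ → ℂ} (hu : IsTest u) : opDy u = fun p => -Complex.I * derY u p := by
  funext p
  simp only [opDy, partialY_eq hu, derY]

lemma covX_const_mul {u : ℝ × ℝ → ℂ} (hu : IsTest u) (c : ℂ) :
    covX (fun p => c * u p) = fun p => c * covX u p := by
  funext p
  simp only [covX]
  rw [fderiv_const_mul (hu.differentiableAt p)]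
  simp only [smul_apply, smul_eq_mul]
  ring

lemma derY_const_mul {u : ℝ × ℝ → ℂ} (hu : IsTest u) (c : ℂ) :
    derY (fun p => c * u p) = fun p => c * derY u p := by
  funext p
  simp only [derY]
  rw [fderiv_const_mul (hu.differentiableAt p)]
  simp only [smul_apply, smul_eq_mul]

lemma covX_sub {u v : ℝ × ℝ → ℂ} (hu : IsTest u) (hv : IsTest v) :
    covX (fun p => u p - v p) = fun p => covX u p - covX v p := by
  funext p
  simp only [covX]
  rw [fderiv_fun_sub (hu.differentiableAt p) (hv.differentiableAt p)]
  simp only [sub_apply]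
  ring

lemma derY_sub {u v : ℝ × ℝ → ℂ} (hu : IsTest u) (hv : IsTest v) :
    derY (fun p => u p - v p) = fun p => derY u p - derY v p := by
  funext p
  simp only [derY]
  rw [fderiv_fun_sub (hu.differentiableAt p) (hv.differentiableAt p)]
  simp only [sub_apply]

lemma formalH_eq (V : ℝ × ℝ → ℝ) {u : ℝ × ℝ → ℂ} (hu : IsTest u) (p : ℝ × ℝ) :
    formalH V u p = -covX (covX u) p - derY (derY u) p + ((p.1 + V p : ℝ) : ℂ) * u p := by
  simp only [formalH]
  rw [opP_eq hu.opP, opP_eq hu, covX_const_mul hu.covX, opDy_eq hu.opDy, opDy_eq hu,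
    derY_const_mul hu.derY]
  push_cast
  linear_combination (covX (covX u) p + derY (derY u) p) * Complex.I_sq

/-- The curvature of the magnetic field: `[∂_y, ∂_x + i y] = i`. -/
lemma derY_covX {u : ℝ × ℝ → ℂ} (hu : IsTest u) (p : ℝ × ℝ) :
    derY (covX u) p = covX (derY u) p + Complex.I * u p := by
  have h1 : ∀ v w : ℝ × ℝ, fderiv ℝ (fun q => fderiv ℝ u q v) p w =
      fderiv ℝ (fderiv ℝ u) p w v := by
    intro v w
    have hd : DifferentiableAt ℝ (fderiv ℝ u) p :=
      (hu.1.fderiv_right (m := ∞) (by simp)).differentiable (by simp) p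
    rw [fderiv_clm_apply hd (differentiableAt_const v)]
    simp
  -- Mixed second derivatives commute, so only the derivative of the coefficient iy contributes to
  -- the commutator.
  have h2 : fderiv ℝ (fderiv ℝ u) p (0, 1) (1, 0) = fderiv ℝ (fderiv ℝ u) p (1, 0) (0, 1) :=
    (hu.1.contDiffAt.isSymmSndFDerivAt (by simpa using WithTop.coe_le_coe.2 (le_top : (2 : ℕ∞) ≤ ⊤))).eq _ _
  have h6 : fderiv ℝ (derY u) p (1, 0) = fderiv ℝ (fderiv ℝ u) p (1, 0) (0, 1) := h1 _ _
  have h3 : HasFDerivAt (fun q : ℝ × ℝ => Complex.I * (q.2 : ℂ))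
      (Complex.I • (Complex.ofRealCLM.comp (ContinuousLinearMap.snd ℝ ℝ ℝ))) p :=
    ((Complex.ofRealCLM.comp (ContinuousLinearMap.snd ℝ ℝ ℝ)).hasFDerivAt).const_mul Complex.I
  have h4 := (((hu.fderiv_apply (1, 0)).differentiableAt p).hasFDerivAt.add
    (h3.mul (hu.differentiableAt p).hasFDerivAt)).fderiv
  have h5 := congrArg (fun L => L ((0, 1) : ℝ × ℝ)) h4
  simp only [derY, covX]
  refine h5.trans ?_
  simp only [add_apply, smul_apply, h1, h2, h6, ContinuousLinearMap.comp_apply,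
    ContinuousLinearMap.coe_snd', Complex.ofRealCLM_apply, smul_eq_mul, Complex.ofReal_one]
  ring

/-! ### Weighted real inner products -/

/-- The real weighted pairing `∫ w Re (f̄ g)`. -/
def wip (w : ℝ × ℝ → ℝ) (f g : ℝ × ℝ → ℂ) : ℝ := ∫ p, w p * inner ℝ (f p) (g p)

lemma wip_symm (w : ℝ × ℝ → ℝ) (f g : ℝ × ℝ → ℂ) : wip w f g = wip w g f := by
  simp only [wip, real_inner_comm]

lemma integrable_wip {w : ℝ × ℝ → ℝ} (hw : Continuous w) {f g : ℝ × ℝ → ℂ} (hf : Continuous f)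
    (hg : Continuous g) (h : HasCompactSupport f) :
    Integrable fun p => w p * inner ℝ (f p) (g p) := by
  refine (hw.mul (hf.inner hg)).integrable_of_hasCompactSupport ?_
  refine h.mono' fun p hp => subset_tsupport _ ?_
  contrapose! hp
  simp [Function.notMem_support.1 hp]

lemma wip_add_right {w : ℝ × ℝ → ℝ} (hw : Continuous w) {f g h : ℝ × ℝ → ℂ} (hf : IsTest f)
    (hg : Continuous g) (hh : Continuous h) :
    wip w f (fun p => g p + h p) = wip w f g + wip w f h := by
  simp only [wip]
  rw [← integral_add (integrable_wip hw hf.1.continuous hg hf.2)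
    (integrable_wip hw hf.1.continuous hh hf.2)]
  simp only [inner_add_right, mul_add]

lemma wip_neg_right (w : ℝ × ℝ → ℝ) (f g : ℝ × ℝ → ℂ) :
    wip w f (fun p => -g p) = -wip w f g := by
  simp only [wip, inner_neg_right, mul_neg, integral_neg]

lemma wip_ofReal_mul_right (w U : ℝ × ℝ → ℝ) (f g : ℝ × ℝ → ℂ) :
    wip w f (fun p => (U p : ℂ) * g p) = wip (fun p => w p * U p) f g := by
  simp only [wip]
  congr 1
  funext p
  rw [← Complex.real_smul, inner_smul_right]
  simp
  ring

lemma wip_add_weight {w₁ w₂ : ℝ × ℝ → ℝ} (h₁ : Continuous w₁) (h₂ : Continuous w₂)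
    {f g : ℝ × ℝ → ℂ} (hf : IsTest f) (hg : Continuous g) :
    wip (fun p => w₁ p + w₂ p) f g = wip w₁ f g + wip w₂ f g := by
  simp only [wip]
  rw [← integral_add (integrable_wip h₁ hf.1.continuous hg hf.2)
    (integrable_wip h₂ hf.1.continuous hg hf.2)]
  simp only [add_mul]

/-- Integration by parts, with boundary terms absent by compact support. The weight is asked only
for a derivative along `e`, because some weights below contain V, which is differentiable in x
alone. -/
lemma wip_fderiv {w w' : ℝ × ℝ → ℝ} (hw : Continuous w) (hw' : Continuous w') {e : ℝ × ℝ}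
    (hd : ∀ p, HasLineDerivAt ℝ w (w' p) p e) {f g : ℝ × ℝ → ℂ} (hf : IsTest f) (hg : IsTest g) :
    wip w f (fun p => fderiv ℝ g p e) =
      -wip w (fun p => fderiv ℝ f p e) g - wip w' f g := by
  have cf := hf.1.continuous
  have cg := hg.1.continuous
  have hf' := hf.fderiv_apply e
  have hg' := hg.fderiv_apply e
  have i1 := integrable_wip hw cf hg'.1.continuous hf.2
  have i2 := integrable_wip hw hf'.1.continuous cg hf'.2
  have i3 := integrable_wip hw' cf cg hf.2
  have key := integral_bilinear_hasLineDerivAt_right_eq_neg_left_of_integrable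
    (μ := (volume : Measure (ℝ × ℝ))) (B := ContinuousLinearMap.mul ℝ ℝ) (v := e)
    (f := w) (f' := w') (g := fun p => inner ℝ (f p) (g p))
    (g' := fun p => inner ℝ (f p) (fderiv ℝ g p e) + inner ℝ (fderiv ℝ f p e) (g p))
    i3 (by simpa only [ContinuousLinearMap.mul_apply', mul_add] using i1.fun_add i2)
    (integrable_wip hw cf cg hf.2) (fun p _ => hd p) (fun p _ => by
      have := ((hf.differentiableAt p).hasFDerivAt.inner ℝ
        (hg.differentiableAt p).hasFDerivAt).hasLineDerivAt e
      simpa using this)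
  simp only [ContinuousLinearMap.mul_apply', mul_add] at key
  rw [integral_add i1 i2] at key
  simp only [wip]
  linarith

/-- Multiplication by iy is skew for the real pairing, so ∂_x + iy integrates by parts exactly as
∂_x does. -/
lemma wip_covX {w w' : ℝ × ℝ → ℝ} (hw : Continuous w) (hw' : Continuous w')
    (hd : ∀ p, HasLineDerivAt ℝ w (w' p) p (1, 0)) {f g : ℝ × ℝ → ℂ} (hf : IsTest f)
    (hg : IsTest g) :
    wip w f (covX g) = -wip w (covX f) g - wip w' f g := by
  have hy : ∀ h : ℝ × ℝ → ℂ, IsTest h →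
      IsTest (fun p => Complex.I * (p.2 : ℂ) * h p) := fun h hh =>
    hh.mul_left (contDiff_const.mul contDiff_snd_complex)
  have e1 : wip w f (covX g) = _ := wip_add_right hw hf (hg.fderiv_apply (1, 0)).1.continuous
    (hy g hg).1.continuous
  have e2 : wip w g (covX f) = _ := wip_add_right hw hg (hf.fderiv_apply (1, 0)).1.continuous
    (hy f hf).1.continuous
  have e3 : wip w f (fun p => Complex.I * (p.2 : ℂ) * g p) =
      -wip w g (fun p => Complex.I * (p.2 : ℂ) * f p) := by
    simp only [wip]
    rw [← integral_neg]
    congr 1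
    funext p
    simp only [Complex.inner, Complex.mul_re, Complex.mul_im, Complex.conj_re, Complex.conj_im,
      Complex.I_re, Complex.I_im, Complex.ofReal_re, Complex.ofReal_im]
    ring
  rw [wip_symm w (covX f) g, e1, e2, e3, wip_fderiv hw hw' hd hf hg, wip_symm w _ g]
  ring

lemma wip_derY {w w' : ℝ × ℝ → ℝ} (hw : Continuous w) (hw' : Continuous w')
    (hd : ∀ p, HasLineDerivAt ℝ w (w' p) p (0, 1)) {f g : ℝ × ℝ → ℂ} (hf : IsTest f)
    (hg : IsTest g) :
    wip w f (derY g) = -wip w (derY f) g - wip w' f g := wip_fderiv hw hw' hd hf hg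

lemma hasLineDerivAt_fst {h h' : ℝ → ℝ} (hd : ∀ t, HasDerivAt h (h' t) t) (p : ℝ × ℝ) :
    HasLineDerivAt ℝ (fun q : ℝ × ℝ => h q.1) (h' p.1) p (1, 0) := by
  have := ((hd p.1).hasFDerivAt.comp p (hasFDerivAt_fst (𝕜 := ℝ) (E := ℝ) (F := ℝ))).hasLineDerivAt
    ((1, 0) : ℝ × ℝ)
  simpa [Function.comp_def] using this

lemma hasLineDerivAt_snd {h h' : ℝ → ℝ} (hd : ∀ t, HasDerivAt h (h' t) t) (p : ℝ × ℝ) :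
    HasLineDerivAt ℝ (fun q : ℝ × ℝ => h q.2) (h' p.2) p (0, 1) := by
  have := ((hd p.2).hasFDerivAt.comp p (hasFDerivAt_snd (𝕜 := ℝ) (E := ℝ) (F := ℝ))).hasLineDerivAt
    ((0, 1) : ℝ × ℝ)
  simpa [Function.comp_def] using this

lemma hasLineDerivAt_fst_zero (h : ℝ → ℝ) (p : ℝ × ℝ) :
    HasLineDerivAt ℝ (fun q : ℝ × ℝ => h q.1) 0 p (0, 1) := by
  simpa [HasLineDerivAt] using hasDerivAt_const (0 : ℝ) (h p.1)

lemma hasLineDerivAt_of_hasDerivAt_fst {F : ℝ × ℝ → ℝ} {F' : ℝ} {p : ℝ × ℝ}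
    (h : HasDerivAt (fun t => F (t, p.2)) F' p.1) : HasLineDerivAt ℝ F F' p (1, 0) := by
  have h0 : HasDerivAt (fun t : ℝ => p.1 + t) 1 0 := (hasDerivAt_id (0 : ℝ)).const_add p.1
  have h1 : HasDerivAt (fun t => F (t, p.2)) F' (p.1 + 0) := by simpa using h
  have := h1.comp (0 : ℝ) h0
  simpa [HasLineDerivAt, Function.comp_def, Prod.add_def] using this

/-! ### Energy and virial identities on test functions -/

/-- `(H - λ) u`. -/
def resid (V : ℝ × ℝ → ℝ) (lam : ℝ) (u : ℝ × ℝ → ℂ) (p : ℝ × ℝ) : ℂ :=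
  formalH V u p - (lam : ℂ) * u p

lemma continuous_resid {V : ℝ × ℝ → ℝ} (hV : Continuous V) (lam : ℝ) {u : ℝ × ℝ → ℂ}
    (hu : IsTest u) : Continuous (resid V lam u) :=
  (formalH_continuous hV hu).sub (continuous_const.mul hu.1.continuous)

lemma hasCompactSupport_resid (V : ℝ × ℝ → ℝ) (lam : ℝ) {u : ℝ × ℝ → ℂ}
    (hu : IsTest u) : HasCompactSupport (resid V lam u) :=
  (formalH_hasCompactSupport V hu).sub (hu.2.mul_left)

/-- Linearity is what allows the energy estimate to be applied to differences of approximants. -/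
lemma resid_sub (V : ℝ × ℝ → ℝ) (lam : ℝ) {u v : ℝ × ℝ → ℂ} (hu : IsTest u) (hv : IsTest v) :
    resid V lam (fun p => u p - v p) = fun p => resid V lam u p - resid V lam v p := by
  funext p
  simp only [resid]
  rw [formalH_eq V (hu.sub hv), formalH_eq V hu, formalH_eq V hv, covX_sub hu hv,
    covX_sub hu.covX hv.covX, derY_sub hu hv, derY_sub hu.derY hv.derY]
  ring

lemma wip_resid {V : ℝ × ℝ → ℝ} (hV : Continuous V) (lam : ℝ) {w : ℝ × ℝ → ℝ} (hw : Continuous w)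
    {h u : ℝ × ℝ → ℂ} (hh : IsTest h) (hu : IsTest u) :
    wip w h (resid V lam u) = -wip w h (covX (covX u)) - wip w h (derY (derY u)) +
      wip (fun p => w p * (p.1 + V p - lam)) h u := by
  have e : resid V lam u = fun p => (-covX (covX u) p + -derY (derY u) p) +
      ((p.1 + V p - lam : ℝ) : ℂ) * u p := by
    funext p
    rw [resid, formalH_eq V hu]
    push_cast
    ring
  have c1 : Continuous fun p => -covX (covX u) p := hu.covX.covX.1.continuous.neg
  have c2 : Continuous fun p => -derY (derY u) p := hu.derY.derY.1.continuous.neg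
  rw [e, wip_add_right hw hh (c1.fun_add c2), wip_add_right hw hh c1 c2, wip_neg_right,
    wip_neg_right, wip_ofReal_mul_right w (fun p => p.1 + V p - lam)]
  · ring
  · exact (Complex.continuous_ofReal.comp (by fun_prop)).mul hu.1.continuous

lemma wip_zero_weight (f g : ℝ × ℝ → ℂ) : wip (fun _ => 0) f g = 0 := by simp [wip]

lemma wip_derY_covX {w : ℝ × ℝ → ℝ} (hw : Continuous w) {h u : ℝ × ℝ → ℂ} (hh : IsTest h)
    (hu : IsTest u) :
    wip w h (derY (covX u)) = wip w h (covX (derY u)) + wip w h (fun p => Complex.I * u p) := by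
  rw [← wip_add_right hw hh hu.derY.covX.1.continuous (hu.const_mul _).1.continuous]
  congr 1
  exact funext (derY_covX hu)

/-- Obtained by pairing the residual with φ(x)u; the weight does not depend on y, so the only
first-order error carries φ'(x). -/
lemma energy_identity {V : ℝ × ℝ → ℝ} (hV : Continuous V) (lam : ℝ) {u : ℝ × ℝ → ℂ}
    (hu : IsTest u) {φ φ₁ : ℝ → ℝ} (hφ : ∀ t, HasDerivAt φ (φ₁ t) t) (c₁ : Continuous φ₁) :
    wip (fun p => φ p.1) (covX u) (covX u) + wip (fun p => φ p.1) (derY u) (derY u) =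
      wip (fun p => φ p.1) u (resid V lam u) - wip (fun p => φ₁ p.1) u (covX u) -
        wip (fun p => φ p.1 * (p.1 + V p - lam)) u u := by
  have c₀ : Continuous φ := continuous_iff_continuousAt.2 fun t => (hφ t).continuousAt
  have w0 : Continuous fun p : ℝ × ℝ => φ p.1 := by fun_prop
  have w1 : Continuous fun p : ℝ × ℝ => φ₁ p.1 := by fun_prop
  rw [wip_resid hV lam w0 hu hu, wip_covX w0 w1 (hasLineDerivAt_fst hφ) hu hu.covX,
    wip_derY w0 continuous_const (hasLineDerivAt_fst_zero φ) hu hu.derY, wip_zero_weight]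
  ring

/-- Obtained by pairing the residual with 2φ(x)(∂_x + iy)u + φ'(x)u. The second multiplier is chosen
so that the terms φ'|∂_y u|² cancel while φ'|(∂_x + iy)u|² doubles. The magnetic commutator leaves
the pairing of iu with ∂_y u. -/
lemma virial_identity_x {V V' : ℝ × ℝ → ℝ} (hV : Continuous V) (hV' : Continuous V')
    (hVd : ∀ p : ℝ × ℝ, HasDerivAt (fun t => V (t, p.2)) (V' p) p.1) (lam : ℝ) {u : ℝ × ℝ → ℂ}
    (hu : IsTest u) {φ φ₁ φ₂ : ℝ → ℝ} (hφ : ∀ t, HasDerivAt φ (φ₁ t) t)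
    (hφ₁ : ∀ t, HasDerivAt φ₁ (φ₂ t) t) (c₂ : Continuous φ₂) :
    2 * wip (fun p => φ₁ p.1) (covX u) (covX u) =
      2 * wip (fun p => φ p.1) (covX u) (resid V lam u) +
      wip (fun p => φ₁ p.1) u (resid V lam u) - wip (fun p => φ₂ p.1) u (covX u) -
      2 * wip (fun p => φ p.1) (fun p => Complex.I * u p) (derY u) +
      wip (fun p => φ p.1 * (1 + V' p)) u u := by
  have c₀ : Continuous φ := continuous_iff_continuousAt.2 fun t => (hφ t).continuousAt
  have c₁ : Continuous φ₁ := continuous_iff_continuousAt.2 fun t => (hφ₁ t).continuousAt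
  have w0 : Continuous fun p : ℝ × ℝ => φ p.1 := by fun_prop
  have w1 : Continuous fun p : ℝ × ℝ => φ₁ p.1 := by fun_prop
  have w2 : Continuous fun p : ℝ × ℝ => φ₂ p.1 := by fun_prop
  have cu := hu.1.continuous
  have hG := hu.covX
  have hE := hu.derY
  have hI := hu.const_mul Complex.I
  have e1 := wip_resid hV lam w0 hG hu
  have e2 := wip_covX w0 w1 (hasLineDerivAt_fst hφ) hG hG
  have e3 := wip_derY w0 continuous_const (hasLineDerivAt_fst_zero φ) hG hE
  have e4 := wip_derY_covX w0 hE hu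
  have e5 := wip_covX w0 w1 (hasLineDerivAt_fst hφ) hE hE
  have e6 := wip_resid hV lam w1 hu hu
  have e7 := wip_covX w1 w2 (hasLineDerivAt_fst hφ₁) hu hG
  have e8 := wip_derY w1 continuous_const (hasLineDerivAt_fst_zero φ₁) hu hE
  -- Here λ leaves: integrating by parts turns the potential terms into one involving only ∂_x(x + V
  -- - λ) = 1 + ∂_x V.
  have e9 := wip_covX (w := fun p => φ p.1 * (p.1 + V p - lam))
    (w' := fun p => φ₁ p.1 * (p.1 + V p - lam) + φ p.1 * (1 + V' p)) (by fun_prop) (by fun_prop)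
    (fun p => hasLineDerivAt_of_hasDerivAt_fst (F := fun p => φ p.1 * (p.1 + V p - lam))
      ((hφ p.1).mul (((hasDerivAt_id p.1).add (hVd p)).sub_const lam))) hu hu
  have e10 := wip_add_weight (w₁ := fun p => φ₁ p.1 * (p.1 + V p - lam))
    (w₂ := fun p => φ p.1 * (1 + V' p)) (by fun_prop) (by fun_prop) hu cu
  have s1 := wip_symm (fun p => φ p.1) (covX (covX u)) (covX u)
  have s2 := wip_symm (fun p => φ p.1) (derY (covX u)) (derY u)
  have s3 := wip_symm (fun p => φ p.1) (covX (derY u)) (derY u)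
  have s4 := wip_symm (fun p => φ p.1) (fun p => Complex.I * u p) (derY u)
  have s5 := wip_symm (fun p => φ p.1 * (p.1 + V p - lam)) (covX u) u
  rw [wip_zero_weight] at e3 e8
  linarith

/-- Obtained by pairing the residual with 2φ(x)φ(y)∂_y u + φ(x)φ'(y)u, which cancels the terms
φ(x)φ'(y)|(∂_x + iy)u|². The weight also depends on x, whence the cross term with φ'(x)φ(y). -/
lemma virial_identity_y {V : ℝ × ℝ → ℝ} (hV : Continuous V) (lam : ℝ) {u : ℝ × ℝ → ℂ}
    (hu : IsTest u) {φ φ₁ φ₂ : ℝ → ℝ} (hφ : ∀ t, HasDerivAt φ (φ₁ t) t)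
    (hφ₁ : ∀ t, HasDerivAt φ₁ (φ₂ t) t) (c₂ : Continuous φ₂) :
    2 * wip (fun p => φ p.1 * φ₁ p.2) (derY u) (derY u) =
      2 * wip (fun p => φ p.1 * φ p.2) (derY u) (resid V lam u) +
      wip (fun p => φ p.1 * φ₁ p.2) u (resid V lam u) +
      2 * wip (fun p => φ p.1 * φ p.2) (fun p => Complex.I * u p) (covX u) -
      2 * wip (fun p => φ₁ p.1 * φ p.2) (derY u) (covX u) -
      wip (fun p => φ₁ p.1 * φ₁ p.2) u (covX u) -
      wip (fun p => φ p.1 * φ₂ p.2) u (derY u) -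
      2 * wip (fun p => φ p.1 * φ p.2 * V p) (derY u) u -
      wip (fun p => φ p.1 * φ₁ p.2 * V p) u u := by
  have c₀ : Continuous φ := continuous_iff_continuousAt.2 fun t => (hφ t).continuousAt
  have c₁ : Continuous φ₁ := continuous_iff_continuousAt.2 fun t => (hφ₁ t).continuousAt
  have w : Continuous fun p : ℝ × ℝ => φ p.1 * φ p.2 := by fun_prop
  have wx : Continuous fun p : ℝ × ℝ => φ₁ p.1 * φ p.2 := by fun_prop
  have wy : Continuous fun p : ℝ × ℝ => φ p.1 * φ₁ p.2 := by fun_prop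
  have wxy : Continuous fun p : ℝ × ℝ => φ₁ p.1 * φ₁ p.2 := by fun_prop
  have wyy : Continuous fun p : ℝ × ℝ => φ p.1 * φ₂ p.2 := by fun_prop
  have dx : ∀ {f f' g : ℝ → ℝ}, (∀ t, HasDerivAt f (f' t) t) → ∀ p : ℝ × ℝ,
      HasLineDerivAt ℝ (fun q : ℝ × ℝ => f q.1 * g q.2) (f' p.1 * g p.2) p (1, 0) :=
    fun {f f' g} hd p => hasLineDerivAt_of_hasDerivAt_fst
      (F := fun q : ℝ × ℝ => f q.1 * g q.2) ((hd p.1).mul_const (g p.2))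
  have dy : ∀ {f g g' : ℝ → ℝ}, (∀ t, HasDerivAt g (g' t) t) → ∀ p : ℝ × ℝ,
      HasLineDerivAt ℝ (fun q : ℝ × ℝ => f q.1 * g q.2) (f p.1 * g' p.2) p (0, 1) := by
    intro f g g' hd p
    have h := HasDerivAt.const_mul (f p.1) (hasLineDerivAt_snd hd p)
    simpa [HasLineDerivAt] using h
  have cu := hu.1.continuous
  have hG := hu.covX
  have hE := hu.derY
  have hI := hu.const_mul Complex.I
  have e1 := wip_resid hV lam w hE hu
  have e2 := wip_derY w wy (dy hφ) hE hE
  have e3 := wip_covX w wx (dx hφ) hE hG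
  have e4 := wip_derY_covX w hG hu
  have e5 := wip_derY w wy (dy hφ) hG hG
  have e6 := wip_resid hV lam wy hu hu
  have e7 := wip_covX wy wxy (dx hφ) hu hG
  have e8 := wip_derY wy wyy (dy hφ₁) hu hE
  -- Only x - λ is integrated by parts: it is constant in y, so its contributions cancel. V stays
  -- undifferentiated, since no ∂_y V is available.
  have e9 := wip_derY (w := fun p => φ p.1 * (p.1 - lam) * φ p.2)
    (w' := fun p => φ p.1 * (p.1 - lam) * φ₁ p.2) (by fun_prop) (by fun_prop)
    (dy (f := fun t => φ t * (t - lam)) hφ) hu hu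
  have e10 := wip_add_weight (w₁ := fun p => φ p.1 * (p.1 - lam) * φ p.2)
    (w₂ := fun p => φ p.1 * φ p.2 * V p) (by fun_prop) (by fun_prop) hE cu
  have e11 := wip_add_weight (w₁ := fun p => φ p.1 * (p.1 - lam) * φ₁ p.2)
    (w₂ := fun p => φ p.1 * φ₁ p.2 * V p) (by fun_prop) (by fun_prop) hu cu
  have r1 : (fun p : ℝ × ℝ => φ p.1 * (p.1 - lam) * φ p.2 + φ p.1 * φ p.2 * V p) =
      fun p => φ p.1 * φ p.2 * (p.1 + V p - lam) := by funext p; ring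
  have r2 : (fun p : ℝ × ℝ => φ p.1 * (p.1 - lam) * φ₁ p.2 + φ p.1 * φ₁ p.2 * V p) =
      fun p => φ p.1 * φ₁ p.2 * (p.1 + V p - lam) := by funext p; ring
  rw [r1] at e10
  rw [r2] at e11
  have s1 := wip_symm (fun p => φ p.1 * φ p.2) (derY (derY u)) (derY u)
  have s2 := wip_symm (fun p => φ p.1 * φ p.2) (covX (derY u)) (covX u)
  have s3 := wip_symm (fun p => φ p.1 * φ p.2) (derY (covX u)) (covX u)
  have s4 := wip_symm (fun p => φ p.1 * φ p.2) (fun p => Complex.I * u p) (covX u)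
  have s5 := wip_symm (fun p => φ p.1 * (p.1 - lam) * φ p.2) (derY u) u
  linarith

/-! ### Weighted norms and the weighted Cauchy–Schwarz inequality -/

lemma wip_self_nonneg {w : ℝ × ℝ → ℝ} (hw : ∀ p, 0 ≤ w p) (f : ℝ × ℝ → ℂ) : 0 ≤ wip w f f :=
  integral_nonneg fun p => mul_nonneg (hw p) real_inner_self_nonneg

/-- The weighted `L²` norm `(∫ w |f|²)^{1/2}`. -/
def wnorm (w : ℝ × ℝ → ℝ) (f : ℝ × ℝ → ℂ) : ℝ := Real.sqrt (wip w f f)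

lemma wnorm_nonneg (w : ℝ × ℝ → ℝ) (f : ℝ × ℝ → ℂ) : 0 ≤ wnorm w f := Real.sqrt_nonneg _

lemma wnorm_sq {w : ℝ × ℝ → ℝ} (hw : ∀ p, 0 ≤ w p) (f : ℝ × ℝ → ℂ) :
    wnorm w f ^ 2 = wip w f f := Real.sq_sqrt (wip_self_nonneg hw f)

lemma abs_wip_le {w w₁ w₂ : ℝ × ℝ → ℝ} {K : ℝ} (hK : 0 ≤ K) (h₁ : Continuous w₁)
    (h₂ : Continuous w₂) (p₁ : ∀ p, 0 ≤ w₁ p) (p₂ : ∀ p, 0 ≤ w₂ p)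
    (hw : ∀ p, |w p| ≤ K * (Real.sqrt (w₁ p) * Real.sqrt (w₂ p))) {f g : ℝ × ℝ → ℂ}
    (cf : Continuous f) (cg : Continuous g) (sf : HasCompactSupport f) (sg : HasCompactSupport g) :
    |wip w f g| ≤ K * wnorm w₁ f * wnorm w₂ g := by
  have hm : ∀ {v : ℝ × ℝ → ℝ} {h : ℝ × ℝ → ℂ}, Continuous v → Continuous h →
      HasCompactSupport h → MemLp (fun p => Real.sqrt (v p) * ‖h p‖) (ENNReal.ofReal 2) := by
    intro v h cv ch sh
    refine Continuous.memLp_of_hasCompactSupport (by fun_prop) ?_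
    exact (sh.norm).mul_left
  have hs : ∀ {v : ℝ × ℝ → ℝ} {h : ℝ × ℝ → ℂ}, (∀ p, 0 ≤ v p) →
      (∫ p, (Real.sqrt (v p) * ‖h p‖) ^ (2 : ℝ)) ^ (1 / 2 : ℝ) = wnorm v h := by
    intro v h hv
    rw [← Real.sqrt_eq_rpow, wnorm, wip]
    congr 2
    funext p
    rw [Real.rpow_two, mul_pow, Real.sq_sqrt (hv p), real_inner_self_eq_norm_sq]
  have key := integral_mul_le_Lp_mul_Lq_of_nonneg (μ := (volume : Measure (ℝ × ℝ)))
    (Real.HolderConjugate.two_two)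
    (Filter.Eventually.of_forall fun p => mul_nonneg (Real.sqrt_nonneg (w₁ p)) (norm_nonneg (f p)))
    (Filter.Eventually.of_forall fun p => mul_nonneg (Real.sqrt_nonneg (w₂ p)) (norm_nonneg (g p)))
    (hm h₁ cf sf) (hm h₂ cg sg)
  rw [hs p₁, hs p₂] at key
  have hi : Integrable fun p => K * ((Real.sqrt (w₁ p) * ‖f p‖) * (Real.sqrt (w₂ p) * ‖g p‖)) := by
    refine Continuous.integrable_of_hasCompactSupport (by fun_prop) ?_
    exact (sf.norm.mul_left.mul_right).mul_left
  calc |wip w f g| = ‖∫ p, w p * inner ℝ (f p) (g p)‖ := rfl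
    _ ≤ ∫ p, K * ((Real.sqrt (w₁ p) * ‖f p‖) * (Real.sqrt (w₂ p) * ‖g p‖)) := by
        refine norm_integral_le_of_norm_le hi (Filter.Eventually.of_forall fun p => ?_)
        rw [norm_mul]
        calc ‖w p‖ * ‖inner ℝ (f p) (g p)‖
            ≤ (K * (Real.sqrt (w₁ p) * Real.sqrt (w₂ p))) * (‖f p‖ * ‖g p‖) :=
              mul_le_mul (hw p) (norm_inner_le_norm _ _) (norm_nonneg _)
                ((abs_nonneg _).trans (hw p))
          _ = _ := by ring
    _ = K * ∫ p, (Real.sqrt (w₁ p) * ‖f p‖) * (Real.sqrt (w₂ p) * ‖g p‖) :=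
        integral_const_mul _ _
    _ ≤ K * (wnorm w₁ f * wnorm w₂ g) := mul_le_mul_of_nonneg_left key hK
    _ = _ := by ring

/-! ### Bounds on the weight -/

namespace IsWeight

variable {a : ℝ} {φ : ℝ → ℝ}

lemma pos (h : IsWeight a φ) (ha : 1 < a) (t : ℝ) : 0 < φ t := by
  rcases le_or_gt t (-a) with h1 | h1
  · rw [h.left t h1]
    exact div_pos_of_neg_of_neg (by norm_num) (by linarith)
  rcases lt_or_ge t a with h2 | h2
  · exact lt_of_lt_of_le (by positivity) (h.middle t h1 h2).1
  · rw [h.right t h2, Real.arctan_pos]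
    linarith [Real.pi_pos]

lemma le_two (h : IsWeight a φ) (ha : 1 < a) (t : ℝ) : φ t ≤ 2 := by
  rcases le_or_gt t (-a) with h1 | h1
  · rw [h.left t h1, div_le_iff_of_neg (by linarith)]
    linarith
  rcases lt_or_ge t a with h2 | h2
  · linarith [(h.middle t h1 h2).2]
  · rw [h.right t h2]
    linarith [Real.arctan_lt_pi_div_two (t - a + Real.pi / 4), Real.pi_le_four]

/-- This compensates for the Stark potential being unbounded below: φ(t)t = -1 on the left, and on
the middle interval φ ≤ 1 and |t| < a. -/
lemma neg_le_mul_self (h : IsWeight a φ) (ha : 1 < a) (t : ℝ) : -a ≤ φ t * t := by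
  have hp := h.pos ha t
  rcases le_or_gt t (-a) with h1 | h1
  · rw [h.left t h1, div_mul_cancel₀ _ (by linarith : t < 0).ne]
    linarith
  rcases lt_or_ge t a with h2 | h2
  · nlinarith [(h.middle t h1 h2).2]
  · nlinarith

lemma hasDerivAt (h : IsWeight a φ) (t : ℝ) : HasDerivAt φ (deriv φ t) t :=
  (h.contDiff.differentiable (by norm_num) t).hasDerivAt

lemma contDiff_deriv (h : IsWeight a φ) : ContDiff ℝ 2 (deriv φ) :=
  ((contDiff_succ_iff_deriv (n := 2)).1 h.contDiff).2.2

lemma hasDerivAt_deriv (h : IsWeight a φ) (t : ℝ) :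
    HasDerivAt (deriv φ) (deriv (deriv φ) t) t :=
  (h.contDiff_deriv.differentiable (by norm_num) t).hasDerivAt

lemma continuous_deriv_deriv (h : IsWeight a φ) : Continuous (deriv (deriv φ)) :=
  ((contDiff_succ_iff_deriv (n := 1)).1 h.contDiff_deriv).2.2.continuous

lemma deriv_left (h : IsWeight a φ) (ha : 1 < a) {t : ℝ} (ht : t < -a) :
    deriv φ t = 1 / t ^ 2 := by
  have he : φ =ᶠ[nhds t] fun x => -1 / x := by
    filter_upwards [Iio_mem_nhds ht] with x hx using h.left x (le_of_lt hx)
  have h0 : t ≠ 0 := by linarith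
  rw [he.deriv_eq]
  have := ((hasDerivAt_const t (-1 : ℝ)).div (hasDerivAt_id t) h0).deriv
  refine this.trans ?_
  simp

lemma deriv_deriv_left (h : IsWeight a φ) (ha : 1 < a) {t : ℝ} (ht : t < -a) :
    deriv (deriv φ) t = -2 / t ^ 3 := by
  have he : deriv φ =ᶠ[nhds t] fun x => 1 / x ^ 2 := by
    filter_upwards [Iio_mem_nhds ht] with x hx using h.deriv_left ha hx
  have h0 : t ≠ 0 := by linarith
  rw [he.deriv_eq]
  have := ((hasDerivAt_const t (1 : ℝ)).div (hasDerivAt_pow 2 t) (pow_ne_zero 2 h0)).deriv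
  refine this.trans ?_
  field_simp
  norm_num
  ring

lemma deriv_right (h : IsWeight a φ) {t : ℝ} (ht : a < t) :
    deriv φ t = 1 / (1 + (t - a + Real.pi / 4) ^ 2) := by
  have he : φ =ᶠ[nhds t] fun x => Real.arctan (x - a + Real.pi / 4) := by
    filter_upwards [Ioi_mem_nhds ht] with x hx using h.right x (le_of_lt hx)
  rw [he.deriv_eq]
  have := (((hasDerivAt_id t).sub_const a).add_const (Real.pi / 4)).arctan.deriv
  refine this.trans ?_
  simp

lemma deriv_deriv_right (h : IsWeight a φ) {t : ℝ} (ht : a < t) :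
    deriv (deriv φ) t =
      -(2 * (t - a + Real.pi / 4)) / (1 + (t - a + Real.pi / 4) ^ 2) ^ 2 := by
  have he : deriv φ =ᶠ[nhds t] fun x => 1 / (1 + (x - a + Real.pi / 4) ^ 2) := by
    filter_upwards [Ioi_mem_nhds ht] with x hx using h.deriv_right hx
  rw [he.deriv_eq]
  have h0 : (1 + (t - a + Real.pi / 4) ^ 2) ≠ 0 := by positivity
  have := ((hasDerivAt_const t (1 : ℝ)).div
    (((((hasDerivAt_id t).sub_const a).add_const (Real.pi / 4)).pow 2).const_add 1) h0).deriv
  refine this.trans ?_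
  simp

/-- Both `φ'` and `φ''` are dominated by `φ`. -/
lemma exists_deriv_bound (h : IsWeight a φ) (ha : 1 < a) :
    ∃ K, a ≤ K ∧ ∀ t, deriv φ t ≤ K * φ t ∧ |deriv (deriv φ) t| ≤ K * φ t := by
  have c0 : Continuous φ := h.contDiff.continuous
  have c1 : Continuous (deriv φ) := h.contDiff_deriv.continuous
  obtain ⟨B₁, hB₁⟩ := (isCompact_Icc (a := -a) (b := a)).exists_bound_of_continuousOn
    (f := fun t => deriv φ t / φ t) (c1.div c0 fun t => (h.pos ha t).ne').continuousOn
  obtain ⟨B₂, hB₂⟩ := (isCompact_Icc (a := -a) (b := a)).exists_bound_of_continuousOn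
    (f := fun t => deriv (deriv φ) t / φ t)
    (h.continuous_deriv_deriv.div c0 fun t => (h.pos ha t).ne').continuousOn
  set c := Real.arctan (Real.pi / 4) with hc
  have hc0 : 0 < c := by rw [hc, Real.arctan_pos]; positivity
  have key : ∀ {k t : ℝ}, k ≤ 2 / c + |B₁| + |B₂| + a + 2 → ∀ {x : ℝ}, x ≤ k * φ t →
      x ≤ (2 / c + |B₁| + |B₂| + a + 2) * φ t := fun hk _ hx =>
    hx.trans (mul_le_mul_of_nonneg_right hk (h.pos ha _).le)
  have hd : 0 < 2 / c := by positivity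
  have n1 := abs_nonneg B₁
  have n2 := abs_nonneg B₂
  -- One summand per region: 2 for the left, where φ' = φ² and φ'' = 2φ³ with φ ≤ 1; |B₁| and |B₂|
  -- for the compact middle; 2/c for the right, where φ ≥ c and the derivatives are at most 2. The
  -- summand a secures a ≤ K. The explicit derivatives need a neighbourhood, so both endpoints ±a go
  -- to the compact part.
  refine ⟨2 / c + |B₁| + |B₂| + a + 2, by linarith, fun t => ?_⟩
  have hp := h.pos ha t
  rcases lt_or_ge t (-a) with h1 | h1
  · have ht : 1 ≤ -t := by linarith
    have hi : 0 < (-t)⁻¹ := by positivity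
    have hi1 : (-t)⁻¹ ≤ 1 := inv_le_one_of_one_le₀ ht
    have e0 : φ t = (-t)⁻¹ := by rw [h.left t h1.le]; field_simp
    have e1 : deriv φ t = (-t)⁻¹ ^ 2 := by rw [h.deriv_left ha h1]; field_simp
    have e2 : deriv (deriv φ) t = 2 * (-t)⁻¹ ^ 3 := by
      rw [h.deriv_deriv_left ha h1]
      have : t ≠ 0 := by linarith
      field_simp
    constructor
    · refine key (k := 2) (by linarith) ?_
      rw [e0, e1]
      nlinarith
    · refine key (k := 2) (by linarith) ?_
      rw [e0, e2, abs_of_pos (by positivity)]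
      nlinarith [pow_le_of_le_one hi.le hi1 (n := 3) (by norm_num)]
  rcases le_or_gt t a with h2 | h2
  · have b1 := (le_abs_self _).trans ((hB₁ t ⟨h1, h2⟩).trans (le_abs_self B₁))
    have b2 := (hB₂ t ⟨h1, h2⟩).trans (le_abs_self B₂)
    rw [div_le_iff₀ hp] at b1
    rw [Real.norm_eq_abs, abs_div, abs_of_pos hp, div_le_iff₀ hp] at b2
    exact ⟨key (by linarith) b1, key (by linarith) b2⟩
  · have hcφ : c ≤ φ t := by
      rw [h.right t h2.le, hc]
      exact Real.arctan_mono (by linarith)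
    have h2φ : 2 ≤ 2 / c * φ t := by
      rw [div_mul_eq_mul_div, le_div_iff₀ hc0]
      linarith
    set r := t - a + Real.pi / 4 with hr
    constructor
    · refine key (k := 2 / c) (by linarith) (le_trans ?_ h2φ)
      rw [h.deriv_right h2, ← hr, div_le_iff₀ (by positivity)]
      nlinarith [sq_nonneg r]
    · refine key (k := 2 / c) (by linarith) (le_trans ?_ h2φ)
      rw [h.deriv_deriv_right h2, ← hr, abs_div, abs_of_pos (by positivity : 0 < (1 + r ^ 2) ^ 2),
        div_le_iff₀ (by positivity), abs_neg, abs_le]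
      constructor <;> nlinarith [sq_nonneg (r - 1), sq_nonneg (r + 1), sq_nonneg (r ^ 2)]

end IsWeight

/-! ### A priori estimates on test functions -/

lemma one_le_japanese (t : ℝ) : 1 ≤ japanese t := by
  rw [japanese, Real.one_le_sqrt]
  nlinarith [sq_nonneg t]

lemma abs_le_japanese (t : ℝ) : |t| ≤ japanese t :=
  Real.abs_le_sqrt (by linarith)

lemma IsPotential.abs_le {s A₀ A₁ : ℝ} {V : ℝ × ℝ → ℝ} (h : IsPotential s A₀ A₁ V)
    (hs : 1 / 2 < s) (p : ℝ × ℝ) : |V p| ≤ A₀ :=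
  (le_mul_of_one_le_left (abs_nonneg _)
    (Real.one_le_rpow (one_le_japanese _) (by linarith))).trans (h.bound p)

lemma IsPotential.abs_partialX_le {s A₀ A₁ : ℝ} {V : ℝ × ℝ → ℝ} (h : IsPotential s A₀ A₁ V)
    (p : ℝ × ℝ) : |partialX V p| ≤ A₁ :=
  (le_mul_of_one_le_left (abs_nonneg _) (one_le_japanese _)).trans (h.bound_partialX p)

/-- The unweighted `L²` norm. -/
abbrev nrm (f : ℝ × ℝ → ℂ) : ℝ := wnorm (fun _ => 1) f

lemma mul_nrm_sq_le_wip {w : ℝ × ℝ → ℝ} (hw : Continuous w) {C : ℝ} (hC : ∀ p, C ≤ w p)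
    {u : ℝ × ℝ → ℂ} (hu : IsTest u) : C * nrm u ^ 2 ≤ wip w u u := by
  rw [wnorm_sq (fun _ => zero_le_one), wip, ← integral_const_mul]
  refine integral_mono ((integrable_wip continuous_const hu.1.continuous hu.1.continuous
    hu.2).const_mul C) (integrable_wip hw hu.1.continuous hu.1.continuous hu.2) fun p => ?_
  simp only [one_mul]
  exact mul_le_mul_of_nonneg_right (hC p) real_inner_self_nonneg

lemma wip_le_mul_nrm_sq {w : ℝ × ℝ → ℝ} (hw : Continuous w) {C : ℝ} (hC : ∀ p, w p ≤ C)
    {u : ℝ × ℝ → ℂ} (hu : IsTest u) : wip w u u ≤ C * nrm u ^ 2 := by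
  have h := mul_nrm_sq_le_wip hw.neg (fun p => neg_le_neg (hC p)) hu
  have e : wip (-w) u u = -wip w u u := by
    simp only [wip, Pi.neg_apply, neg_mul, integral_neg]
  linarith

lemma nrm_I_mul (u : ℝ × ℝ → ℂ) : nrm (fun p => Complex.I * u p) = nrm u := by
  simp only [nrm, wnorm, wip, real_inner_self_eq_norm_sq, norm_mul, Complex.norm_I, one_mul]

variable {a A₀ A₁ K : ℝ} {φ : ℝ → ℝ} {V : ℝ × ℝ → ℝ} {u : ℝ × ℝ → ℂ}

lemma IsWeight.le_two_mul_sqrt (hφ : IsWeight a φ) (ha : 1 < a) (t : ℝ) :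
    φ t ≤ 2 * Real.sqrt (φ t) := by
  have h0 := (hφ.pos ha t).le
  have h1 := Real.mul_self_sqrt h0
  have h2 : Real.sqrt (φ t) ≤ 2 := Real.sqrt_le_iff.2 ⟨by norm_num, by linarith [hφ.le_two ha t]⟩
  nlinarith [Real.sqrt_nonneg (φ t)]

/-- The potential term is bounded below through φ(x)x ≥ -a and φ ≤ 2, and the first-order error is
absorbed using φ' ≤ Kφ ≤ 2K√φ. The bound stays quadratic in `u`, so that it applies to differences.
-/
lemma energy_estimate (ha : 1 < a) (hφ : IsWeight a φ) (hK : a ≤ K)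
    (h₁ : ∀ t, deriv φ t ≤ K * φ t) (hV : Continuous V) (hA₀ : ∀ p, |V p| ≤ A₀) (lam : ℝ)
    (hu : IsTest u) :
    wnorm (fun p => φ p.1) (covX u) ^ 2 + wnorm (fun p => φ p.1) (derY u) ^ 2 ≤
      2 * (2 * K ^ 2 + K + 2 * A₀ + 2) *
        (nrm u * nrm (resid V lam u) + japanese lam * nrm u ^ 2) := by
  have c0 : Continuous φ := hφ.contDiff.continuous
  have w0 : ∀ p : ℝ × ℝ, 0 ≤ φ p.1 := fun p => (hφ.pos ha p.1).le
  have hA : 0 ≤ A₀ := (abs_nonneg _).trans (hA₀ 0)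
  have hK0 : 0 ≤ K := by linarith
  have cf := continuous_resid hV lam hu
  have sf := hasCompactSupport_resid V lam hu
  have cu := hu.1.continuous
  have key := energy_identity hV lam hu hφ.hasDerivAt hφ.contDiff_deriv.continuous
  have b1 := abs_wip_le (w := fun p => φ p.1) (w₁ := fun _ => 1) (w₂ := fun _ => 1) (K := 2)
    (by norm_num) continuous_const continuous_const (fun _ => zero_le_one) (fun _ => zero_le_one)
    (fun p => by simpa [abs_of_nonneg (w0 p)] using hφ.le_two ha p.1) cu cf hu.2 sf
  have b2 := abs_wip_le (w := fun p => deriv φ p.1) (w₁ := fun _ => 1) (w₂ := fun p => φ p.1)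
    (K := 2 * K) (by positivity) continuous_const (by fun_prop) (fun _ => zero_le_one) w0
    (fun p => by
      rw [abs_of_pos (hφ.deriv_pos _), Real.sqrt_one, one_mul]
      nlinarith [h₁ p.1, hφ.le_two_mul_sqrt ha p.1]) cu hu.covX.1.continuous hu.2 hu.covX.2
  have hL := abs_le_japanese lam
  have hL1 := one_le_japanese lam
  have b3 := mul_nrm_sq_le_wip (w := fun p => φ p.1 * (p.1 + V p - lam))
    (C := -((K + 2 * A₀ + 2) * japanese lam)) (by fun_prop) (fun p => by
      have e1 := hφ.neg_le_mul_self ha p.1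
      have e2 := hφ.le_two ha p.1
      have e3 : -(A₀ + japanese lam) ≤ V p - lam := by
        linarith [(abs_le.1 (hA₀ p)).1, (abs_le.1 hL).2]
      have e4 : -(2 * (A₀ + japanese lam)) ≤ φ p.1 * (V p - lam) := by nlinarith [w0 p]
      nlinarith) hu
  have hN := wnorm_nonneg (fun _ => 1) u
  have hF := wnorm_nonneg (fun _ => 1) (resid V lam u)
  rw [← wnorm_sq w0, ← wnorm_sq w0] at key
  simp only [nrm] at *
  set N := wnorm (fun _ => 1) u
  set F := wnorm (fun _ => 1) (resid V lam u)
  set x := wnorm (fun p => φ p.1) (covX u)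
  set y := wnorm (fun p => φ p.1) (derY u)
  have b1' := (abs_le.1 b1).2
  have b2' := (abs_le.1 b2).1
  -- Half of x² is absorbed on the left, which accounts for the overall factor 2 in the constant.
  have q1 : 2 * K * N * x ≤ x ^ 2 / 2 + 2 * K ^ 2 * N ^ 2 := by nlinarith [sq_nonneg (x - 2 * K * N)]
  have q2 : 2 * K ^ 2 * N ^ 2 ≤ 2 * K ^ 2 * (japanese lam * N ^ 2) :=
    mul_le_mul_of_nonneg_left (by nlinarith [sq_nonneg N]) (by positivity)
  have q3 : 0 ≤ (4 * K ^ 2 + 2 * K + 4 * A₀) * (N * F) := by positivity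
  nlinarith [sq_nonneg y]

/-- Cauchy–Schwarz on each term of the virial identity. The right side contains no λ and is at most
linear in the energy norms, which is where the exponent is gained. -/
lemma virial_estimate_x (ha : 1 < a) (hφ : IsWeight a φ) (hK : a ≤ K)
    (h₁ : ∀ t, deriv φ t ≤ K * φ t) (h₂ : ∀ t, |deriv (deriv φ) t| ≤ K * φ t)
    {s : ℝ} (hV : IsPotential s A₀ A₁ V) (lam : ℝ) (hu : IsTest u) :
    2 * wnorm (fun p => deriv φ p.1) (covX u) ^ 2 ≤
      4 * wnorm (fun p => φ p.1) (covX u) * nrm (resid V lam u) +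
      2 * K * nrm u * nrm (resid V lam u) + 2 * K * nrm u * wnorm (fun p => φ p.1) (covX u) +
      4 * nrm u * wnorm (fun p => φ p.1) (derY u) + 2 * (1 + A₁) * nrm u ^ 2 := by
  have c0 : Continuous φ := hφ.contDiff.continuous
  have c1 : Continuous (deriv φ) := hφ.contDiff_deriv.continuous
  have w0 : ∀ p : ℝ × ℝ, 0 ≤ φ p.1 := fun p => (hφ.pos ha p.1).le
  have w1 : ∀ p : ℝ × ℝ, 0 ≤ deriv φ p.1 := fun p => (hφ.deriv_pos p.1).le
  have hK0 : 0 ≤ K := by linarith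
  have cV := hV.continuous
  have cV' := hV.continuous_partialX
  have cf := continuous_resid cV lam hu
  have sf := hasCompactSupport_resid V lam hu
  have cu := hu.1.continuous
  have hI := hu.const_mul Complex.I
  have key := virial_identity_x cV cV' (fun p => (hV.differentiable_x p).hasDerivAt) lam hu
    hφ.hasDerivAt hφ.hasDerivAt_deriv hφ.continuous_deriv_deriv
  have b1 := abs_wip_le (w := fun p => φ p.1) (w₁ := fun p => φ p.1) (w₂ := fun _ => 1) (K := 2)
    (by norm_num) (by fun_prop) continuous_const w0 (fun _ => zero_le_one)
    (fun p => by simpa [abs_of_nonneg (w0 p)] using hφ.le_two_mul_sqrt ha p.1)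
    hu.covX.1.continuous cf hu.covX.2 sf
  have b2 := abs_wip_le (w := fun p => deriv φ p.1) (w₁ := fun _ => 1) (w₂ := fun _ => 1)
    (K := 2 * K) (by positivity) continuous_const continuous_const (fun _ => zero_le_one)
    (fun _ => zero_le_one) (fun p => by
      rw [abs_of_pos (hφ.deriv_pos _), Real.sqrt_one]
      nlinarith [h₁ p.1, hφ.le_two ha p.1]) cu cf hu.2 sf
  have b3 := abs_wip_le (w := fun p => deriv (deriv φ) p.1) (w₁ := fun _ => 1)
    (w₂ := fun p => φ p.1)
    (K := 2 * K) (by positivity) continuous_const (by fun_prop) (fun _ => zero_le_one) w0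
    (fun p => by
      rw [Real.sqrt_one, one_mul]
      nlinarith [h₂ p.1, hφ.le_two_mul_sqrt ha p.1]) cu hu.covX.1.continuous hu.2 hu.covX.2
  have b4 := abs_wip_le (w := fun p => φ p.1) (w₁ := fun _ => 1) (w₂ := fun p => φ p.1) (K := 2)
    (by norm_num) continuous_const (by fun_prop) (fun _ => zero_le_one) w0
    (fun p => by simpa [abs_of_nonneg (w0 p)] using hφ.le_two_mul_sqrt ha p.1)
    hI.1.continuous hu.derY.1.continuous hI.2 hu.derY.2
  have b5 := wip_le_mul_nrm_sq (w := fun p => φ p.1 * (1 + partialX V p))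
    (C := 2 * (1 + A₁)) (by fun_prop) (fun p => by
      have e2 := hφ.le_two ha p.1
      have e3 := hV.abs_partialX_le p
      nlinarith [w0 p, (abs_le.1 e3).2, abs_nonneg (partialX V p)]) hu
  rw [← wnorm_sq w1] at key
  have hn := nrm_I_mul u
  simp only [nrm] at *
  rw [hn] at b4
  linarith [(abs_le.1 b1).2, (abs_le.1 b2).2, (abs_le.1 b3).1, (abs_le.1 b4).1]

/-- The decisive term is the product of the energy norm of ∂_y u and the φ'-weighted norm of (∂_x +
iy)u; the latter is already improved by the virial estimate in x. -/
lemma virial_estimate_y (ha : 1 < a) (hφ : IsWeight a φ) (hK : a ≤ K)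
    (h₁ : ∀ t, deriv φ t ≤ K * φ t) (h₂ : ∀ t, |deriv (deriv φ) t| ≤ K * φ t)
    (hV : Continuous V) (hA₀ : ∀ p, |V p| ≤ A₀) (lam : ℝ) (hu : IsTest u) :
    2 * wnorm (fun p => φ p.1 * deriv φ p.2) (derY u) ^ 2 ≤
      8 * wnorm (fun p => φ p.1) (derY u) * nrm (resid V lam u) +
      4 * K * nrm u * nrm (resid V lam u) + 8 * nrm u * wnorm (fun p => φ p.1) (covX u) +
      4 * K * wnorm (fun p => φ p.1) (derY u) * wnorm (fun p => deriv φ p.1) (covX u) +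
      4 * K ^ 2 * nrm u * wnorm (fun p => φ p.1) (covX u) +
      4 * K * nrm u * wnorm (fun p => φ p.1) (derY u) +
      8 * A₀ * wnorm (fun p => φ p.1) (derY u) * nrm u + 4 * K * A₀ * nrm u ^ 2 := by
  have c0 : Continuous φ := hφ.contDiff.continuous
  have c1 : Continuous (deriv φ) := hφ.contDiff_deriv.continuous
  have w0 : ∀ p : ℝ × ℝ, 0 ≤ φ p.1 := fun p => (hφ.pos ha p.1).le
  have w1 : ∀ p : ℝ × ℝ, 0 ≤ deriv φ p.1 := fun p => (hφ.deriv_pos p.1).le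
  have t0 : ∀ p : ℝ × ℝ, 0 ≤ φ p.2 := fun p => (hφ.pos ha p.2).le
  have t1 : ∀ p : ℝ × ℝ, 0 ≤ deriv φ p.2 := fun p => (hφ.deriv_pos p.2).le
  have t2 : ∀ p : ℝ × ℝ, φ p.2 ≤ 2 := fun p => hφ.le_two ha p.2
  have hq : ∀ p : ℝ × ℝ, φ p.1 ≤ 2 * Real.sqrt (φ p.1) := fun p => hφ.le_two_mul_sqrt ha p.1
  have hA : 0 ≤ A₀ := (abs_nonneg _).trans (hA₀ 0)
  have hK0 : 0 ≤ K := by linarith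
  have t3 : ∀ p : ℝ × ℝ, deriv φ p.2 ≤ 2 * K := fun p => by nlinarith [h₁ p.2, t2 p]
  have t4 : ∀ p : ℝ × ℝ, |deriv (deriv φ) p.2| ≤ 2 * K := fun p => by nlinarith [h₂ p.2, t2 p]
  -- Since K ≥ a > 1, φ' ≤ Kφ ≤ K²φ; one factor √φ' is kept and the other is traded for K√φ.
  have hr : ∀ p : ℝ × ℝ, deriv φ p.1 ≤
      K * (Real.sqrt (φ p.1) * Real.sqrt (deriv φ p.1)) := fun p => by
    have e1 : Real.sqrt (deriv φ p.1) ≤ K * Real.sqrt (φ p.1) := by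
      rw [Real.sqrt_le_iff]
      refine ⟨by positivity, ?_⟩
      rw [mul_pow, Real.sq_sqrt (w0 p)]
      nlinarith [h₁ p.1, mul_nonneg hK0 (w0 p)]
    nlinarith [Real.mul_self_sqrt (w1 p), Real.sqrt_nonneg (deriv φ p.1)]
  have cf := continuous_resid hV lam hu
  have sf := hasCompactSupport_resid V lam hu
  have cu := hu.1.continuous
  have hI := hu.const_mul Complex.I
  have hE := hu.derY
  have hG := hu.covX
  have key := virial_identity_y hV lam hu
    hφ.hasDerivAt hφ.hasDerivAt_deriv hφ.continuous_deriv_deriv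
  have b1 := abs_wip_le (w := fun p => φ p.1 * φ p.2) (w₁ := fun p => φ p.1) (w₂ := fun _ => 1)
    (K := 4) (by norm_num) (by fun_prop) continuous_const w0 (fun _ => zero_le_one)
    (fun p => by
      rw [abs_of_nonneg (mul_nonneg (w0 p) (t0 p)), Real.sqrt_one, mul_one]
      nlinarith [mul_le_mul (hq p) (t2 p) (t0 p) (by positivity)])
    hE.1.continuous cf hE.2 sf
  have b2 := abs_wip_le (w := fun p => φ p.1 * deriv φ p.2) (w₁ := fun _ => 1) (w₂ := fun _ => 1)
    (K := 4 * K) (by positivity) continuous_const continuous_const (fun _ => zero_le_one)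
    (fun _ => zero_le_one) (fun p => by
      rw [abs_of_nonneg (mul_nonneg (w0 p) (t1 p)), Real.sqrt_one]
      nlinarith [mul_le_mul (hφ.le_two ha p.1) (t3 p) (t1 p) (by norm_num)]) cu cf hu.2 sf
  have b3 := abs_wip_le (w := fun p => φ p.1 * φ p.2) (w₁ := fun _ => 1) (w₂ := fun p => φ p.1)
    (K := 4) (by norm_num) continuous_const (by fun_prop) (fun _ => zero_le_one) w0
    (fun p => by
      rw [abs_of_nonneg (mul_nonneg (w0 p) (t0 p)), Real.sqrt_one, one_mul]
      nlinarith [mul_le_mul (hq p) (t2 p) (t0 p) (by positivity)])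
    hI.1.continuous hG.1.continuous hI.2 hG.2
  have b4 := abs_wip_le (w := fun p => deriv φ p.1 * φ p.2) (w₁ := fun p => φ p.1)
    (w₂ := fun p => deriv φ p.1) (K := 2 * K) (by positivity) (by fun_prop) (by fun_prop) w0 w1
    (fun p => by
      rw [abs_of_nonneg (mul_nonneg (w1 p) (t0 p))]
      nlinarith [mul_le_mul (hr p) (t2 p) (t0 p) (by positivity)])
    hE.1.continuous hG.1.continuous hE.2 hG.2
  have b5 := abs_wip_le (w := fun p => deriv φ p.1 * deriv φ p.2) (w₁ := fun _ => 1)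
    (w₂ := fun p => φ p.1) (K := 4 * K ^ 2) (by positivity) continuous_const (by fun_prop)
    (fun _ => zero_le_one) w0
    (fun p => by
      rw [abs_of_nonneg (mul_nonneg (w1 p) (t1 p)), Real.sqrt_one, one_mul]
      have e1 : deriv φ p.1 ≤ K * (2 * Real.sqrt (φ p.1)) :=
        (h₁ p.1).trans (mul_le_mul_of_nonneg_left (hq p) hK0)
      nlinarith [mul_le_mul e1 (t3 p) (t1 p) (by positivity)])
    cu hG.1.continuous hu.2 hG.2
  have b6 := abs_wip_le (w := fun p => φ p.1 * deriv (deriv φ) p.2) (w₁ := fun _ => 1)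
    (w₂ := fun p => φ p.1) (K := 4 * K) (by positivity) continuous_const (by fun_prop)
    (fun _ => zero_le_one) w0
    (fun p => by
      rw [abs_mul, abs_of_nonneg (w0 p), Real.sqrt_one, one_mul]
      nlinarith [mul_le_mul (hq p) (t4 p) (abs_nonneg _) (by positivity)])
    cu hE.1.continuous hu.2 hE.2
  have b7 := abs_wip_le (w := fun p => φ p.1 * φ p.2 * V p) (w₁ := fun p => φ p.1)
    (w₂ := fun _ => 1) (K := 4 * A₀) (by positivity) (by fun_prop) continuous_const w0
    (fun _ => zero_le_one)
    (fun p => by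
      rw [abs_mul, abs_of_nonneg (mul_nonneg (w0 p) (t0 p)), Real.sqrt_one, mul_one]
      nlinarith [mul_le_mul (mul_le_mul (hq p) (t2 p) (t0 p) (by positivity)) (hA₀ p)
        (abs_nonneg _) (by positivity)])
    hE.1.continuous cu hE.2 hu.2
  have b8 := mul_nrm_sq_le_wip (w := fun p => φ p.1 * deriv φ p.2 * V p)
    (C := -(4 * K * A₀)) (by fun_prop) (fun p => by
      have e := mul_le_mul (mul_le_mul (hφ.le_two ha p.1) (t3 p) (t1 p) (by norm_num)) (hA₀ p)
        (abs_nonneg _) (by positivity)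
      have e2 := neg_abs_le (φ p.1 * deriv φ p.2 * V p)
      rw [abs_mul, abs_of_nonneg (mul_nonneg (w0 p) (t1 p))] at e2
      linarith) hu
  rw [← wnorm_sq (fun p => mul_nonneg (w0 p) (t1 p))] at key
  have hn := nrm_I_mul u
  simp only [nrm] at *
  rw [hn] at b3
  linarith [(abs_le.1 b1).2, (abs_le.1 b2).2, (abs_le.1 b3).2, (abs_le.1 b4).1,
    (abs_le.1 b5).1, (abs_le.1 b6).1, (abs_le.1 b7).1]

/-- The a priori bounds on test functions, with constants depending only on `a, φ, A₀, A₁`. -/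
lemma exists_test_estimates {a A₀ A₁ : ℝ} {φ : ℝ → ℝ} (ha : 1 < a) (hA₀ : 0 < A₀) (hA₁ : 0 < A₁)
    (hφ : IsWeight a φ) :
    ∃ M C K : ℝ, 0 < M ∧ 0 < C ∧ 0 < K ∧ (∀ t, deriv φ t ≤ K * φ t) ∧
      ∀ (s : ℝ) (V : ℝ × ℝ → ℝ), 1 / 2 < s → IsPotential s A₀ A₁ V →
      ∀ (lam : ℝ) (u : ℝ × ℝ → ℂ), IsTest u →
        wnorm (fun p => φ p.1) (covX u) ^ 2 + wnorm (fun p => φ p.1) (derY u) ^ 2 ≤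
          M * (nrm u * nrm (resid V lam u) + japanese lam * nrm u ^ 2) ∧
        (nrm u ≤ 2 → nrm (resid V lam u) ≤ 1 →
          wnorm (fun p => deriv φ p.1) (covX u) ≤ C * japanese lam ^ (1 / 4 : ℝ) ∧
          wnorm (fun p => φ p.1 * deriv φ p.2) (derY u) ≤ C * japanese lam ^ (3 / 8 : ℝ)) := by
  obtain ⟨K, hK, hKφ⟩ := hφ.exists_deriv_bound ha
  have hK0 : 0 < K := by linarith
  set M := 2 * (2 * K ^ 2 + K + 2 * A₀ + 2) with hM
  have hM0 : 1 ≤ M := by rw [hM]; nlinarith [sq_nonneg K]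
  -- With ‖u‖ ≤ 2 and ‖f‖ ≤ 1, ‖u‖‖f‖ + ⟨λ⟩‖u‖² ≤ 2 + 4⟨λ⟩ ≤ 6⟨λ⟩. Thus μ⟨λ⟩^{1/2} bounds both
  -- energy norms; γ and δ below play the same role for the two virial bounds.
  set μ := Real.sqrt (6 * M) with hμ
  have hμ1 : 1 ≤ μ := by rw [hμ, Real.one_le_sqrt]; linarith
  have hμ2 : μ ^ 2 = 6 * M := Real.sq_sqrt (by linarith)
  set M₂ := 20 + 8 * K + 8 * A₁ with hM₂
  set γ := Real.sqrt (M₂ * μ) with hγ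
  have hM₂0 : 0 < M₂ := by positivity
  have hγ0 : 0 < γ := Real.sqrt_pos.2 (by positivity)
  have hγ2 : γ ^ 2 = M₂ * μ := Real.sq_sqrt (by positivity)
  set M₃ := 24 + 24 * K + 8 * K ^ 2 + 16 * A₀ + 16 * K * A₀ with hM₃
  set δ := Real.sqrt (M₃ * μ + 4 * K * μ * γ) with hδ
  have hM₃0 : 0 < M₃ := by positivity
  have hδ0 : 0 < δ := Real.sqrt_pos.2 (by positivity)
  have hδ2 : δ ^ 2 = M₃ * μ + 4 * K * μ * γ := Real.sq_sqrt (by positivity)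
  clear_value μ γ δ M M₂ M₃
  refine ⟨M, γ + δ, K, by linarith, by linarith, hK0, fun t => (hKφ t).1, ?_⟩
  intro s V hs hV lam u hu
  have energy := energy_estimate ha hφ hK (fun t => (hKφ t).1) hV.continuous
    (fun p => hV.abs_le hs p) lam hu
  rw [← hM] at energy
  refine ⟨energy, fun hN hF => ?_⟩
  have hx := virial_estimate_x ha hφ hK (fun t => (hKφ t).1) (fun t => (hKφ t).2) hV lam hu
  have hy := virial_estimate_y ha hφ hK (fun t => (hKφ t).1) (fun t => (hKφ t).2) hV.continuous
    (fun p => hV.abs_le hs p) lam hu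
  have hL := one_le_japanese lam
  have hL0 : 0 ≤ japanese lam := by linarith
  -- An eighth root makes the exponents 1/2, 1/4 and 3/8 the natural powers ℓ⁴, ℓ² and ℓ³.
  set ℓ := japanese lam ^ (1 / 8 : ℝ) with hℓ
  have hℓ1 : 1 ≤ ℓ := Real.one_le_rpow hL (by norm_num)
  have hpow : ∀ n : ℕ, ℓ ^ n = japanese lam ^ ((n : ℝ) / 8) := fun n => by
    rw [hℓ, ← Real.rpow_natCast, ← Real.rpow_mul hL0]
    congr 1
    ring
  have p8 : japanese lam = ℓ ^ 8 := by rw [hpow]; norm_num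
  have p2 : japanese lam ^ (1 / 4 : ℝ) = ℓ ^ 2 := by rw [hpow]; norm_num
  have p3 : japanese lam ^ (3 / 8 : ℝ) = ℓ ^ 3 := by rw [hpow]; norm_num
  clear_value ℓ
  rw [p2, p3]
  rw [p8] at energy
  have nN := wnorm_nonneg (fun _ => 1) u
  have nF := wnorm_nonneg (fun _ => 1) (resid V lam u)
  have na := wnorm_nonneg (fun p => φ p.1) (covX u)
  have nb := wnorm_nonneg (fun p => φ p.1) (derY u)
  have nc := wnorm_nonneg (fun p => deriv φ p.1) (covX u)
  have nd := wnorm_nonneg (fun p => φ p.1 * deriv φ p.2) (derY u)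
  simp only [nrm] at *
  generalize wnorm (fun _ => 1) u = N at *
  generalize wnorm (fun _ => 1) (resid V lam u) = F at *
  generalize wnorm (fun p => φ p.1) (covX u) = x at *
  generalize wnorm (fun p => φ p.1) (derY u) = y at *
  generalize wnorm (fun p => deriv φ p.1) (covX u) = c at *
  generalize wnorm (fun p => φ p.1 * deriv φ p.2) (derY u) = d at *
  have hℓ0 : 0 ≤ ℓ := by linarith
  have m1 : 1 ≤ μ * ℓ ^ 4 := one_le_mul_of_one_le_of_one_le hμ1 (one_le_pow₀ hℓ1)
  have m0 : 0 ≤ μ * ℓ ^ 4 := by linarith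
  have hNF : N * F ≤ 2 * 1 := mul_le_mul hN hF nF (by norm_num)
  have hN2 : N ^ 2 ≤ 2 ^ 2 := pow_le_pow_left₀ nN hN 2
  have hE : x ^ 2 + y ^ 2 ≤ (μ * ℓ ^ 4) ^ 2 := by
    have e1 : N * F + ℓ ^ 8 * N ^ 2 ≤ 6 * ℓ ^ 8 := by
      have h1 : 1 ≤ ℓ ^ 8 := one_le_pow₀ hℓ1
      have h2 : ℓ ^ 8 * N ^ 2 ≤ ℓ ^ 8 * 2 ^ 2 := mul_le_mul_of_nonneg_left hN2 (by positivity)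
      linarith
    calc x ^ 2 + y ^ 2 ≤ M * (6 * ℓ ^ 8) :=
          energy.trans (mul_le_mul_of_nonneg_left e1 (by linarith))
      _ = (μ * ℓ ^ 4) ^ 2 := by rw [mul_pow, hμ2]; ring
  have hxm : x ≤ μ * ℓ ^ 4 := abs_le_of_sq_le_sq' (by linarith [sq_nonneg y]) m0 |>.2
  have hym : y ≤ μ * ℓ ^ 4 := abs_le_of_sq_le_sq' (by linarith [sq_nonneg x]) m0 |>.2
  generalize hm : μ * ℓ ^ 4 = m at *
  have hxF : x * F ≤ m * 1 := mul_le_mul hxm hF nF m0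
  have hyF : y * F ≤ m * 1 := mul_le_mul hym hF nF m0
  have hNx : N * x ≤ 2 * m := mul_le_mul hN hxm na (by norm_num)
  have hNy : N * y ≤ 2 * m := mul_le_mul hN hym nb (by norm_num)
  have hc : c ≤ γ * ℓ ^ 2 := by
    refine (abs_le_of_sq_le_sq' ?_ (by positivity)).2
    have e2 : (γ * ℓ ^ 2) ^ 2 = M₂ * m := by rw [mul_pow, hγ2, ← hm]; ring
    rw [e2]
    have k1 : K * (N * F) ≤ K * (2 * m) := mul_le_mul_of_nonneg_left (by linarith) hK0.le
    have k2 : K * (N * x) ≤ K * (2 * m) := mul_le_mul_of_nonneg_left hNx hK0.le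
    have k3 : (1 + A₁) * N ^ 2 ≤ (1 + A₁) * (4 * m) :=
      mul_le_mul_of_nonneg_left (by linarith) (by linarith)
    have k4 : 0 ≤ K * m := by positivity
    have k5 : 0 ≤ A₁ * m := by positivity
    rw [hM₂]
    linarith
  refine ⟨hc.trans (mul_le_mul_of_nonneg_right (by linarith) (by positivity)), ?_⟩
  refine le_trans ?_ (mul_le_mul_of_nonneg_right (by linarith : δ ≤ γ + δ) (by positivity))
  refine (abs_le_of_sq_le_sq' ?_ (by positivity)).2
  have e3 : M₃ * m + 4 * K * m * (γ * ℓ ^ 2) ≤ (δ * ℓ ^ 3) ^ 2 := by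
    rw [mul_pow, hδ2, ← hm]
    have : M₃ * μ * ℓ ^ 4 ≤ M₃ * μ * ℓ ^ 6 :=
      mul_le_mul_of_nonneg_left (pow_le_pow_right₀ hℓ1 (by norm_num)) (by positivity)
    linarith
  refine le_trans ?_ e3
  have k1 : K * (N * F) ≤ K * (2 * m) := mul_le_mul_of_nonneg_left (by linarith) hK0.le
  have k2 : K ^ 2 * (N * x) ≤ K ^ 2 * (2 * m) := mul_le_mul_of_nonneg_left hNx (by positivity)
  have k3 : K * (N * y) ≤ K * (2 * m) := mul_le_mul_of_nonneg_left hNy hK0.le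
  have k4 : A₀ * (N * y) ≤ A₀ * (2 * m) := mul_le_mul_of_nonneg_left hNy hA₀.le
  have k5 : K * A₀ * N ^ 2 ≤ K * A₀ * (4 * m) :=
    mul_le_mul_of_nonneg_left (by linarith) (by positivity)
  have k6 : K * (y * c) ≤ K * (m * (γ * ℓ ^ 2)) :=
    mul_le_mul_of_nonneg_left (mul_le_mul hym hc nc m0) hK0.le
  have k7 : 0 ≤ K * m := by positivity
  have k8 : 0 ≤ K ^ 2 * m := by positivity
  have k9 : 0 ≤ K * A₀ * m := by positivity
  have k10 : 0 ≤ K * (m * (γ * ℓ ^ 2)) := by positivity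
  have k11 : 0 ≤ A₀ * m := by positivity
  rw [hM₃]
  linarith

/-! ### Passage to the limit -/

lemma IsTest.memLp_sqrt_mul {w : ℝ × ℝ → ℝ} (hw : Continuous w) {h : ℝ × ℝ → ℂ} (hh : IsTest h) :
    MemLp (fun p => (Real.sqrt (w p) : ℂ) * h p) 2 volume :=
  (((Complex.continuous_ofReal.comp (by fun_prop)).mul hh.1.continuous :
    Continuous fun p => (Real.sqrt (w p) : ℂ) * h p)).memLp_of_hasCompactSupport hh.2.mul_left

lemma eLpNorm_eq_ofReal_wnorm {w : ℝ × ℝ → ℝ} (p₀ : ∀ p, 0 ≤ w p)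
    {h : ℝ × ℝ → ℂ} (hm : MemLp (fun p => (Real.sqrt (w p) : ℂ) * h p) 2 volume) :
    eLpNorm (fun p => (Real.sqrt (w p) : ℂ) * h p) 2 volume = ENNReal.ofReal (wnorm w h) := by
  rw [hm.eLpNorm_eq_integral_rpow_norm (by norm_num) (by norm_num), wnorm, Real.sqrt_eq_rpow, wip]
  congr 2
  · congr 1
    funext p
    rw [ENNReal.toReal_ofNat, Real.rpow_two, norm_mul, mul_pow, real_inner_self_eq_norm_sq,
      Complex.norm_real, Real.norm_eq_abs, sq_abs, Real.sq_sqrt (p₀ p)]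
  · norm_num

lemma nrm_eq_norm {f : L2} {h : ℝ × ℝ → ℂ} (hf : f =ᵐ[volume] h) : nrm h = ‖f‖ := by
  have e : (fun p => (Real.sqrt 1 : ℂ) * h p) = h := by funext p; simp
  have hm : MemLp h 2 volume := (memLp_congr_ae hf).1 (Lp.memLp f)
  have := eLpNorm_eq_ofReal_wnorm (w := fun _ => 1) (fun _ => zero_le_one) (h := h) (by simpa using hm)
  rw [e] at this
  rw [Lp.norm_def, eLpNorm_congr_ae hf, this, ENNReal.toReal_ofReal (wnorm_nonneg _ _)]

lemma tendsto_integral_mul {T : ℕ → L2} {S : L2} (hT : Filter.Tendsto T Filter.atTop (nhds S))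
    {k : ℝ × ℝ → ℂ} (ck : Continuous k) (sk : HasCompactSupport k) :
    Filter.Tendsto (fun n => ∫ p, T n p * k p) Filter.atTop (nhds (∫ p, S p * k p)) := by
  have hv : MemLp (fun p => (starRingEnd ℂ) (k p)) 2 volume :=
    (Complex.continuous_conj.comp ck).memLp_of_hasCompactSupport
      (sk.comp_left (g := (starRingEnd ℂ)) (by simp))
  have e : ∀ f : L2, inner ℂ (hv.toLp _) f = ∫ p, f p * k p := fun f => by
    rw [inner_toLp]
    simp only [Complex.conj_conj, mul_comm]
  simp only [← e]
  exact Filter.Tendsto.inner tendsto_const_nhds hT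

lemma integrable_mul_test (f : L2) {k : ℝ × ℝ → ℂ} (ck : Continuous k)
    (sk : HasCompactSupport k) : Integrable fun p => f p * k p := by
  simpa only [smul_eq_mul] using
    ((Lp.memLp f).locallyIntegrable (by norm_num)).integrable_smul_right_of_hasCompactSupport ck sk

lemma locallyIntegrable_continuous_mul (f : L2) {k : ℝ × ℝ → ℂ} (ck : Continuous k) :
    LocallyIntegrable fun p => k p * f p := by
  have h := (Lp.memLp f).locallyIntegrable (by norm_num)
  rw [← locallyIntegrableOn_univ] at h ⊢
  exact h.continuousOn_mul ck.continuousOn isOpen_univ.isLocallyClosed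

/-- Limits of covariant derivatives of test functions are weak derivatives of the limit. -/
lemma integral_weak_limit {u : ℕ → ℝ × ℝ → ℂ} (hu : ∀ n, IsTest (u n)) {e : ℝ × ℝ}
    {β : ℝ × ℝ → ℂ} (hβ : Continuous β) {ρ : ℝ × ℝ → ℂ} (hρ : Continuous ρ) (hρ0 : ∀ p, ρ p ≠ 0)
    {U T : ℕ → L2} {ψ S : L2} (hU : Filter.Tendsto U Filter.atTop (nhds ψ))
    (hT : Filter.Tendsto T Filter.atTop (nhds S)) (eU : ∀ n, U n =ᵐ[volume] u n)
    (eT : ∀ n, T n =ᵐ[volume] fun p => ρ p * (fderiv ℝ (u n) p e + β p * u n p))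
    {η : ℝ × ℝ → ℂ} (hη : IsTest η) :
    ∫ p, ((ρ p)⁻¹ * S p - β p * ψ p) * η p = -∫ p, ψ p * fderiv ℝ η p e := by
  have c1 : Continuous fun p => (ρ p)⁻¹ * η p := (hρ.inv₀ hρ0).mul hη.1.continuous
  have s1 : HasCompactSupport fun p => (ρ p)⁻¹ * η p := hη.2.mul_left
  have c2 : Continuous fun p => β p * η p := hβ.mul hη.1.continuous
  have s2 : HasCompactSupport fun p => β p * η p := hη.2.mul_left
  have hη' := hη.fderiv_apply e
  have l1 := (tendsto_integral_mul hT c1 s1).sub (tendsto_integral_mul hU c2 s2)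
  have l2 := (tendsto_integral_mul hU hη'.1.continuous hη'.2).neg
  have hI : ∀ {f g : ℝ × ℝ → ℂ}, IsTest f → IsTest g → Integrable (fun p => f p * g p) :=
    fun hf hg => (hg.mul_left hf.1).1.continuous.integrable_of_hasCompactSupport
      (hg.mul_left hf.1).2
  -- Almost everywhere T_n/ρ - βU_n is the derivative of u_n along `e`, so this is integration by
  -- parts before the limit.
  have heq : ∀ n, (∫ p, T n p * ((ρ p)⁻¹ * η p)) - ∫ p, U n p * (β p * η p) =
      -∫ p, U n p * fderiv ℝ η p e := fun n => by
    rw [← integral_sub (integrable_mul_test _ c1 s1) (integrable_mul_test _ c2 s2)]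
    have a1 : ∫ p, (T n p * ((ρ p)⁻¹ * η p) - U n p * (β p * η p)) =
        ∫ p, η p * fderiv ℝ (u n) p e := by
      refine integral_congr_ae ?_
      filter_upwards [eU n, eT n] with p h1 h2
      rw [h1, h2]
      field_simp [hρ0 p]
      ring
    have a2 : ∫ p, U n p * fderiv ℝ η p e = ∫ p, fderiv ℝ η p e * u n p := by
      refine integral_congr_ae ?_
      filter_upwards [eU n] with p h1
      rw [h1, mul_comm]
    rw [a1, a2]
    exact integral_mul_fderiv_eq_neg_fderiv_mul_of_integrable
      (hI hη' (hu n)) (hI hη ((hu n).fderiv_apply e)) (hI hη (hu n))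
      (fun p _ => hη.differentiableAt p) (fun p _ => (hu n).differentiableAt p)
  simp only [heq] at l1
  rw [tendsto_nhds_unique l2 l1, ← integral_sub (integrable_mul_test _ c1 s1)
    (integrable_mul_test _ c2 s2)]
  congr 1
  funext p
  ring

/-- Multiplication by a bounded function is continuous on L², so ‖mS‖ ≤ B‖S - T_n‖ + C, and the
first term tends to zero. -/
lemma memLp_mul_limit {T : ℕ → L2} {S : L2} (hT : Filter.Tendsto T Filter.atTop (nhds S))
    {m : ℝ × ℝ → ℂ} (cm : Continuous m) {B : ℝ} (hm : ∀ p, ‖m p‖ ≤ B) {C : ENNReal}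
    (hC : ∀ n, eLpNorm (fun p => m p * T n p) 2 volume ≤ C) :
    MemLp (fun p => m p * S p) 2 volume ∧ eLpNorm (fun p => m p * S p) 2 volume ≤ C := by
  have hmem : ∀ f : L2, MemLp (fun p => m p * f p) 2 volume := fun f =>
    (Lp.memLp f).of_le_mul (c := B) (cm.aestronglyMeasurable.mul (Lp.aestronglyMeasurable f))
      (Filter.Eventually.of_forall fun p => by
        rw [norm_mul]
        exact mul_le_mul_of_nonneg_right (hm p) (norm_nonneg _))
  refine ⟨hmem S, ?_⟩
  have hle : ∀ n, eLpNorm (fun p => m p * S p) 2 volume ≤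
      ENNReal.ofReal B * ENNReal.ofReal ‖S - T n‖ + C := fun n => by
    have e1 : (fun p => m p * S p) =ᵐ[volume]
        (fun p => m p * (S - T n : L2) p) + fun p => m p * T n p := by
      filter_upwards [Lp.coeFn_sub S (T n)] with p h
      simp only [Pi.add_apply, h, Pi.sub_apply]
      ring
    rw [eLpNorm_congr_ae e1]
    refine (eLpNorm_add_le (hmem _).1 (hmem _).1 (by norm_num)).trans (add_le_add ?_ (hC n))
    refine (eLpNorm_le_mul_eLpNorm_of_ae_le_mul (c := B) (g := (S - T n : L2)) (Filter.Eventually.of_forall fun p => ?_)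
      2).trans ?_
    · rw [norm_mul]
      exact mul_le_mul_of_nonneg_right (hm p) (norm_nonneg _)
    · rw [Lp.norm_def, ENNReal.ofReal_toReal (Lp.memLp _).2.ne]
  have hlim : Filter.Tendsto (fun n => ENNReal.ofReal B * ENNReal.ofReal ‖S - T n‖ + C)
      Filter.atTop (nhds (ENNReal.ofReal B * ENNReal.ofReal 0 + C)) := by
    refine (ENNReal.Tendsto.const_mul (ENNReal.tendsto_ofReal ?_)
      (Or.inr ENNReal.ofReal_ne_top)).add tendsto_const_nhds
    simpa using (tendsto_const_nhds (x := S)).sub hT |>.norm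
  simpa using ge_of_tendsto' hlim hle

lemma cauchySeq_of_dist_le_mul {α β : Type*} [PseudoMetricSpace α] [PseudoMetricSpace β]
    {z : ℕ → α} {T : ℕ → β} (hz : CauchySeq z) {c : ℝ} (hc : 0 ≤ c)
    (h : ∀ n m, dist (T n) (T m) ≤ c * dist (z n) (z m)) : CauchySeq T := by
  rw [Metric.cauchySeq_iff] at hz ⊢
  intro ε hε
  obtain ⟨N, hN⟩ := hz (ε / (c + 1)) (by positivity)
  refine ⟨N, fun m hm n hn => ?_⟩
  calc dist (T m) (T n) ≤ c * dist (z m) (z n) := h m n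
    _ ≤ (c + 1) * dist (z m) (z n) := by nlinarith [dist_nonneg (x := z m) (y := z n)]
    _ < (c + 1) * (ε / (c + 1)) := by gcongr; exact hN m hm n hn
    _ = ε := by field_simp

lemma dist_toLp_sqrt_mul {w : ℝ × ℝ → ℝ} (hw : Continuous w) (p₀ : ∀ p, 0 ≤ w p)
    {f g : ℝ × ℝ → ℂ} (hf : IsTest f) (hg : IsTest g) :
    dist (hf.memLp_sqrt_mul hw).toLp (hg.memLp_sqrt_mul hw).toLp =
      wnorm w (fun p => f p - g p) := by
  have e : (fun p => (Real.sqrt (w p) : ℂ) * f p) - (fun p => (Real.sqrt (w p) : ℂ) * g p) =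
      fun p => (Real.sqrt (w p) : ℂ) * (f p - g p) := by
    funext p
    simp only [Pi.sub_apply]
    ring
  rw [dist_eq_norm, ← MemLp.toLp_sub, Lp.norm_toLp, e,
    eLpNorm_eq_ofReal_wnorm p₀ ((hf.sub hg).memLp_sqrt_mul hw),
    ENNReal.toReal_ofReal (wnorm_nonneg _ _)]

/-- An eigenfunction is the limit of test functions `u n` with `(H - λ) u n → 0`. -/
lemma IsEigenfunction.exists_seq {V : ℝ × ℝ → ℝ} (hV : Continuous V) {lam : ℝ} {ψ : L2}
    (h : IsEigenfunction V lam ψ) (h1 : ‖ψ‖ = 1) :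
    ∃ (u : ℕ → ℝ × ℝ → ℂ) (U R : ℕ → L2), (∀ n, IsTest (u n)) ∧ (∀ n, U n =ᵐ[volume] u n) ∧
      (∀ n, R n =ᵐ[volume] resid V lam (u n)) ∧ Filter.Tendsto U Filter.atTop (nhds ψ) ∧
      CauchySeq R ∧ ∀ n, ‖U n‖ ≤ 2 ∧ ‖R n‖ ≤ 1 := by
  obtain ⟨-, hd, he⟩ := h
  have hg : (ψ, (lam : ℂ) • ψ) ∈ (minimalGraph V).topologicalClosure := by
    rw [← hamiltonian_graph hV, ← he]
    exact (hamiltonian V).mem_graph ⟨ψ, hd⟩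
  obtain ⟨q, hq, hlim⟩ := mem_closure_iff_seq_limit.1 hg
  have l1 : Filter.Tendsto (fun n => (q n).1) Filter.atTop (nhds ψ) :=
    (continuous_fst.tendsto _).comp hlim
  have l2 : Filter.Tendsto (fun n => (q n).2 - (lam : ℂ) • (q n).1) Filter.atTop (nhds 0) := by
    simpa using ((continuous_snd.tendsto _).comp hlim).sub (l1.const_smul (lam : ℂ))
  -- The two norms tend to 1 and 0; discarding finitely many terms makes the bounds 2 and 1 hold
  -- throughout.
  have ev : ∀ᶠ n in Filter.atTop, ‖(q n).1‖ ≤ 2 ∧ ‖(q n).2 - (lam : ℂ) • (q n).1‖ ≤ 1 :=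
    (l1.norm.eventually_le_const (by rw [h1]; norm_num)).and
      (l2.norm.eventually_le_const (by rw [norm_zero]; norm_num))
  obtain ⟨k, hk⟩ := Filter.eventually_atTop.1 ev
  choose u hu e1 e2 using hq
  refine ⟨fun n => u (n + k), fun n => (q (n + k)).1,
    fun n => (q (n + k)).2 - (lam : ℂ) • (q (n + k)).1, fun n => hu _, fun n => e1 _, fun n => ?_,
    (Filter.tendsto_add_atTop_iff_nat k).2 l1,
    ((Filter.tendsto_add_atTop_iff_nat k).2 l2).cauchySeq, fun n => hk _ (by omega)⟩
  filter_upwards [Lp.coeFn_sub (q (n + k)).2 ((lam : ℂ) • (q (n + k)).1),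
    Lp.coeFn_smul (lam : ℂ) (q (n + k)).1, e1 (n + k), e2 (n + k)] with p a1 a2 a3 a4
  rw [a1, Pi.sub_apply, a2, Pi.smul_apply, a3, a4, resid, smul_eq_mul]

end MagneticStark

end

/-! ### The estimates for eigenfunctions -/

open MagneticStark in
theorem lemma2p6 (a A₀ A₁ : ℝ) (ha : 1 < a) (hA₀ : 0 < A₀) (hA₁ : 0 < A₁)
    (φ : ℝ → ℝ) (hφ : MagneticStark.IsWeight a φ) :
    ∃ C : ℝ, 0 < C ∧ ∀ (s : ℝ) (V : ℝ × ℝ → ℝ), 1 / 2 < s → MagneticStark.IsPotential s A₀ A₁ V →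
      ∀ (lam : ℝ) (ψ : MagneticStark.L2), MagneticStark.IsEigenfunction V lam ψ → ‖ψ‖ = 1 →
        ∃ gx gy : ℝ × ℝ → ℂ, MagneticStark.IsWeakDx ψ gx ∧ MagneticStark.IsWeakDy ψ gy ∧
          MemLp (fun p : ℝ × ℝ =>
            (Real.sqrt (deriv φ p.1) : ℂ) * (gx p + (p.2 : ℂ) * ψ p)) 2 volume ∧
          eLpNorm (fun p : ℝ × ℝ =>
            (Real.sqrt (deriv φ p.1) : ℂ) * (gx p + (p.2 : ℂ) * ψ p)) 2 volume ≤
              ENNReal.ofReal (C * MagneticStark.japanese lam ^ (1 / 4 : ℝ)) ∧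
          MemLp (fun p : ℝ × ℝ =>
            (Real.sqrt (φ p.1) : ℂ) * (Real.sqrt (deriv φ p.2) : ℂ) * gy p) 2 volume ∧
          eLpNorm (fun p : ℝ × ℝ =>
            (Real.sqrt (φ p.1) : ℂ) * (Real.sqrt (deriv φ p.2) : ℂ) * gy p) 2 volume ≤
              ENNReal.ofReal (C * MagneticStark.japanese lam ^ (3 / 8 : ℝ)) := by
  obtain ⟨M, C, K, hM, hC, hK, hKφ, est⟩ := exists_test_estimates ha hA₀ hA₁ hφ
  refine ⟨C, hC, fun s V hs hV lam ψ hψ h1 => ?_⟩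
  obtain ⟨u, U, R, hu, eU, eR, hU, hR, hb⟩ := hψ.exists_seq hV.continuous h1
  have c0 : Continuous φ := hφ.contDiff.continuous
  have c1 : Continuous (deriv φ) := hφ.contDiff_deriv.continuous
  have w0 : ∀ p : ℝ × ℝ, 0 ≤ φ p.1 := fun p => (hφ.pos ha p.1).le
  have cw : Continuous fun p : ℝ × ℝ => φ p.1 := by fun_prop
  have cw1 : Continuous fun p : ℝ × ℝ => deriv φ p.1 := by fun_prop
  have cw2 : Continuous fun p : ℝ × ℝ => φ p.1 * deriv φ p.2 := by fun_prop
  set ρ : ℝ × ℝ → ℂ := fun p => (Real.sqrt (φ p.1) : ℂ) with hρdef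
  have hρ : Continuous ρ := Complex.continuous_ofReal.comp (by fun_prop)
  have hρ0 : ∀ p, ρ p ≠ 0 := fun p =>
    Complex.ofReal_ne_zero.2 (Real.sqrt_pos.2 (hφ.pos ha p.1)).ne'
  have hnρ : ∀ p, ‖ρ p‖ = Real.sqrt (φ p.1) := fun p => by
    rw [hρdef, Complex.norm_real, Real.norm_eq_abs, abs_of_nonneg (Real.sqrt_nonneg _)]
  -- Convergence of the weighted derivatives of the approximating test functions.
  have hz : CauchySeq fun n => (U n, R n) := hU.cauchySeq.prodMk hR
  -- If both ‖U_n - U_m‖ and ‖R_n - R_m‖ are at most D, the energy bound is at most M(D² + ⟨λ⟩D²) ≤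
  -- 2M⟨λ⟩D².
  set κ := Real.sqrt (2 * M * japanese lam) with hκ
  have hdist : ∀ n m,
      wnorm (fun p => φ p.1) (covX fun p => u n p - u m p) ≤ κ * dist (U n, R n) (U m, R m) ∧
      wnorm (fun p => φ p.1) (derY fun p => u n p - u m p) ≤ κ * dist (U n, R n) (U m, R m) := by
    intro n m
    have h := (est s V hs hV lam _ ((hu n).sub (hu m))).1
    have e1 : nrm (fun p => u n p - u m p) = ‖U n - U m‖ := nrm_eq_norm (by
      filter_upwards [Lp.coeFn_sub (U n) (U m), eU n, eU m] with p a b c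
      rw [a, Pi.sub_apply, b, c])
    have e2 : nrm (resid V lam fun p => u n p - u m p) = ‖R n - R m‖ := nrm_eq_norm (by
      rw [resid_sub V lam (hu n) (hu m)]
      filter_upwards [Lp.coeFn_sub (R n) (R m), eR n, eR m] with p a b c
      rw [a, Pi.sub_apply, b, c])
    have d1 : ‖U n - U m‖ ≤ dist (U n, R n) (U m, R m) := by
      rw [Prod.dist_eq, ← dist_eq_norm]; exact le_max_left _ _
    have d2 : ‖R n - R m‖ ≤ dist (U n, R n) (U m, R m) := by
      rw [Prod.dist_eq, ← dist_eq_norm (R n)]; exact le_max_right _ _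
    rw [e1, e2] at h
    set D := dist (U n, R n) (U m, R m)
    have hD : 0 ≤ D := dist_nonneg
    have hL := one_le_japanese lam
    have f1 : ‖U n - U m‖ * ‖R n - R m‖ ≤ D * D := mul_le_mul d1 d2 (norm_nonneg _) hD
    have f2 : ‖U n - U m‖ ^ 2 ≤ D ^ 2 := pow_le_pow_left₀ (norm_nonneg _) d1 2
    have f3 : ‖U n - U m‖ * ‖R n - R m‖ + japanese lam * ‖U n - U m‖ ^ 2 ≤
        2 * japanese lam * D ^ 2 := by nlinarith [sq_nonneg D]
    have f4 : (κ * D) ^ 2 = M * (2 * japanese lam * D ^ 2) := by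
      rw [mul_pow, hκ, Real.sq_sqrt (by positivity)]; ring
    have f5 := h.trans (mul_le_mul_of_nonneg_left f3 hM.le)
    rw [← f4] at f5
    have f6 : 0 ≤ κ * D := mul_nonneg (Real.sqrt_nonneg _) hD
    exact ⟨(abs_le_of_sq_le_sq' (le_trans (le_add_of_nonneg_right (sq_nonneg _)) f5) f6).2,
      (abs_le_of_sq_le_sq' (le_trans (le_add_of_nonneg_left (sq_nonneg _)) f5) f6).2⟩
  obtain ⟨S, hS⟩ := cauchySeq_tendsto_of_complete
    (cauchySeq_of_dist_le_mul (T := fun n => ((hu n).covX.memLp_sqrt_mul cw).toLp) hz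
      (Real.sqrt_nonneg _) fun n m => by
        rw [dist_toLp_sqrt_mul cw w0 (hu n).covX (hu m).covX, ← covX_sub (hu n) (hu m)]
        exact (hdist n m).1)
  obtain ⟨S', hS'⟩ := cauchySeq_tendsto_of_complete
    (cauchySeq_of_dist_le_mul (T := fun n => ((hu n).derY.memLp_sqrt_mul cw).toLp) hz
      (Real.sqrt_nonneg _) fun n m => by
        rw [dist_toLp_sqrt_mul cw w0 (hu n).derY (hu m).derY, ← derY_sub (hu n) (hu m)]
        exact (hdist n m).2)
  have eT := fun n => ((hu n).covX.memLp_sqrt_mul cw).coeFn_toLp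
  have eT' := fun n => ((hu n).derY.memLp_sqrt_mul cw).coeFn_toLp
  have hβ : Continuous fun p : ℝ × ℝ => Complex.I * (p.2 : ℂ) := by fun_prop
  have fin := fun n => (est s V hs hV lam _ (hu n)).2 (by rw [nrm_eq_norm (eU n)]; exact (hb n).1)
    (by rw [nrm_eq_norm (eR n)]; exact (hb n).2)
  -- The limits, multiplied by bounded functions.
  have cm : Continuous fun p : ℝ × ℝ => -Complex.I * (Real.sqrt (deriv φ p.1) : ℂ) * (ρ p)⁻¹ :=
    (continuous_const.mul (Complex.continuous_ofReal.comp (by fun_prop))).mul (hρ.inv₀ hρ0)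
  have cm' : Continuous fun p : ℝ × ℝ => -Complex.I * (Real.sqrt (deriv φ p.2) : ℂ) :=
    continuous_const.mul (Complex.continuous_ofReal.comp (by fun_prop))
  -- The multiplier replaces the weight √φ(x) by √φ'(x); it is bounded by √K because φ' ≤ Kφ.
  have bx := memLp_mul_limit hS cm (B := Real.sqrt K) (fun p => by
      rw [norm_mul, norm_mul, norm_neg, Complex.norm_I, one_mul, norm_inv, hnρ, Complex.norm_real,
        Real.norm_eq_abs, abs_of_nonneg (Real.sqrt_nonneg _), ← div_eq_mul_inv,
        div_le_iff₀ (Real.sqrt_pos.2 (hφ.pos ha p.1)), ← Real.sqrt_mul hK.le]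
      exact Real.sqrt_le_sqrt (hKφ p.1))
    (C := ENNReal.ofReal (C * japanese lam ^ (1 / 4 : ℝ))) (fun n => by
      rw [eLpNorm_congr_norm_ae (g := fun p => (Real.sqrt (deriv φ p.1) : ℂ) * covX (u n) p),
        eLpNorm_eq_ofReal_wnorm (fun p => (hφ.deriv_pos p.1).le) ((hu n).covX.memLp_sqrt_mul cw1)]
      · exact ENNReal.ofReal_le_ofReal (fin n).1
      · filter_upwards [eT n] with p h
        rw [h]
        have : ‖ρ p‖ ≠ 0 := norm_ne_zero_iff.2 (hρ0 p)
        change ‖_ * (ρ p * _)‖ = _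
        simp only [norm_mul, norm_neg, Complex.norm_I, one_mul, norm_inv]
        field_simp)
  have bY := memLp_mul_limit hS' cm' (B := Real.sqrt (2 * K)) (fun p => by
      rw [norm_mul, norm_neg, Complex.norm_I, one_mul, Complex.norm_real,
        Real.norm_eq_abs, abs_of_nonneg (Real.sqrt_nonneg _)]
      exact Real.sqrt_le_sqrt (by nlinarith [hKφ p.2, hφ.le_two ha p.2]))
    (C := ENNReal.ofReal (C * japanese lam ^ (3 / 8 : ℝ))) (fun n => by
      rw [eLpNorm_congr_norm_ae
          (g := fun p => (Real.sqrt (φ p.1 * deriv φ p.2) : ℂ) * derY (u n) p),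
        eLpNorm_eq_ofReal_wnorm (fun p => mul_nonneg (w0 p) (hφ.deriv_pos p.2).le)
          ((hu n).derY.memLp_sqrt_mul cw2)]
      · exact ENNReal.ofReal_le_ofReal (fin n).2
      · filter_upwards [eT' n] with p h
        rw [h, Real.sqrt_mul (w0 p)]
        simp only [norm_mul, norm_neg, Complex.norm_I, one_mul, Complex.ofReal_mul]
        ring)
  have ex : (fun p : ℝ × ℝ => (Real.sqrt (deriv φ p.1) : ℂ) *
      (-Complex.I * ((ρ p)⁻¹ * S p - Complex.I * (p.2 : ℂ) * ψ p) + (p.2 : ℂ) * ψ p)) =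
      fun p => -Complex.I * (Real.sqrt (deriv φ p.1) : ℂ) * (ρ p)⁻¹ * S p := by
    funext p
    linear_combination (Real.sqrt (deriv φ p.1) : ℂ) * (p.2 : ℂ) * ψ p * Complex.I_sq
  have ey : (fun p : ℝ × ℝ => (Real.sqrt (φ p.1) : ℂ) * (Real.sqrt (deriv φ p.2) : ℂ) *
      (-Complex.I * ((ρ p)⁻¹ * S' p - 0 * ψ p))) =
      fun p => -Complex.I * (Real.sqrt (deriv φ p.2) : ℂ) * S' p := by
    funext p
    change ρ p * _ * _ = _
    field_simp [hρ0 p]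
    ring
  -- S is the limit of √φ(∂_x + iy)u_n, so ∂_xψ = S/√φ - iyψ, and the yψ terms cancel in (D_x + y)ψ.
  -- The vanishing term `0 * ψ p` is the case β = 0 of the weak-limit lemma.
  refine ⟨fun p => -Complex.I * ((ρ p)⁻¹ * S p - Complex.I * (p.2 : ℂ) * ψ p),
    fun p => -Complex.I * ((ρ p)⁻¹ * S' p - 0 * ψ p), ⟨?_, fun η hη => ?_⟩, ⟨?_, fun η hη => ?_⟩,
    ?_, ?_, ?_, ?_⟩
  · exact ((locallyIntegrable_continuous_mul S (hρ.inv₀ hρ0)).sub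
      (locallyIntegrable_continuous_mul ψ hβ)).smul (-Complex.I)
  · have h := integral_weak_limit hu hβ hρ hρ0 hU hS eU eT hη
    simp only [opDx, partialX_eq hη]
    calc _ = -Complex.I * ∫ p, ((ρ p)⁻¹ * S p - Complex.I * (p.2 : ℂ) * ψ p) * η p := by
          rw [← integral_const_mul]; congr 1; funext p; ring
      _ = -(-Complex.I * ∫ p, ψ p * fderiv ℝ η p (1, 0)) := by rw [h]; ring
      _ = _ := by rw [← integral_const_mul]; congr 2; funext p; ring
  · exact ((locallyIntegrable_continuous_mul S' (hρ.inv₀ hρ0)).sub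
      (locallyIntegrable_continuous_mul ψ continuous_const)).smul (-Complex.I)
  · have h := integral_weak_limit hu (β := fun _ => 0) continuous_const hρ hρ0 hU hS' eU
      (fun n => by simp only [zero_mul, add_zero]; exact eT' n) hη
    simp only [opDy, partialY_eq hη]
    calc _ = -Complex.I * ∫ p, ((ρ p)⁻¹ * S' p - 0 * ψ p) * η p := by
          rw [← integral_const_mul]; congr 1; funext p; ring
      _ = -(-Complex.I * ∫ p, ψ p * fderiv ℝ η p (0, 1)) := by rw [h]; ring
      _ = _ := by rw [← integral_const_mul]; congr 2; funext p; ring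
  · rw [ex]; exact bx.1
  · rw [ex]; exact bx.2
  · rw [ey]; exact bY.1
  · rw [ey]; exact bY.2
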